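/- **Conventions.** A metric space is geodesic if any two of its points are joined by a geodesic segment (an isometrically embedded interval), and it is $\mathrm{CAT}(0)$ if it is geodesic and for all geodesic segments $[x,y]$, $[x,z]$ and all points $p\in[x,y]$, $q\in[x,z]$ one has $d(p,q)\le d(\bar p,\bar q)$, where $\bar p,\bar q$ are the corresponding points on a Euclidean comparison triangle of $x,y,z$. A subset is convex if it contains every geodesic segment joining two of its points. The space of directions $\Sigma_xX$ is the set of nondegenerate geodesic segments issuing from $x$, where segments making Alexandrov angle $0$ are identified, with the angle as metric. The geometric dimension is $\mathrm{GD}(X)=0$ if $X$ is discrete and $\mathrm{GD}(X)=1+\sup_{x\in X}\mathrm{GD}(\Sigma_xX)$ otherwise. For an isometry $g$ of $X$ put $\ell(g)=\inf_{x\in X}d(x,gx)$; $g$ is semisimple if the infimum is attained, and then elliptic if $\ell(g)=0$ and hyperbolic if $\ell(g)>0$; $g$ is parabolic if the infimum is not attained. A group $\Gamma$ of isometries of $X$ is discrete if $\{g\in\Gamma : d(x,gx)<\eta\}$ is finite for all $x\in X$ and $\eta\ge 0$. A group is virtually nilpotent (resp. virtually abelian) if it has a nilpotent (resp. abelian) subgroup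 of finite index. **Proposition 2.6.** Let $X$ be a nonempty complete $\mathrm{CAT}(0)$-space with $\mathrm{GD}(X)<+\infty$, and let $\Gamma$ be a finitely generated, discrete, virtually nilpotent group of isometries of $X$. Then there exist an integer $k\ge 0$, a nonempty metric space $W$ and an isometric embedding of the $\ell^2$-product $W\times\mathbb{R}^k$ onto a $\Gamma$-invariant convex subset of $X$ (with which it is identified), and subgroups $\Gamma_W, Z\le\Gamma$ with $Z\cong\mathbb{Z}^k$, such that: 1. $\Gamma$ acts on $W\times\mathbb{R}^k$ componentwise: there are homomorphisms $\gamma\mapsto\gamma'\in\mathrm{Isom}(W)$ and $\gamma\mapsto\gamma''\in\mathrm{Isom}(\mathbb{R}^k)$ such that every $\gamma\in\Gamma$ acts on $W\times\mathbb{R}^k$ as $(\gamma',\gamma'')$; and $\gamma'$ is not hyperbolic for any $\gamma\in\Gamma$. 2. $\Gamma_W$ and $Z$ commute, intersect trivially, and together generate a normal subgroup $H=\Gamma_W\times Z\cong\Gamma_W\times\mathbb{Z}^k$ of finite index in $\Gamma$. The group $\Gamma_W$ is finitely generated and nilpotent, and $\gamma\mapsto\gamma'$ maps it injectively onto a discrete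 group of isometries of $W$ without hyperbolic elements. The group $Z\cong\mathbb{Z}^k$ acts trivially on $W$ and acts on $\mathbb{R}^k$ as a lattice of translations: its $k$ generators act as the translations by the vectors of a basis of $\mathbb{R}^k$. 3. The set of those elements of $H=\Gamma_W\times Z$ that are semisimple as isometries of $X$ is a virtually abelian normal subgroup of $\Gamma$, and it coincides with the set of $\gamma\in H$ such that $\gamma'$ is elliptic. Moreover: 4. If $\Gamma$ contains no parabolic isometry, then $\Gamma$ is virtually abelian. -/

import Mathlib

universe u

noncomputable section

namespace CATZero

open Set Filter Topology

/-! ### Geodesics, convexity and the CAT(0) condition -/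

/-- `c` restricted to `[0, l]` is a geodesic (an isometric embedding of `[0, l]`); the values of `c`
outside `[0, l]` are irrelevant. -/
def IsGeodesicOn {X : Type u} [Dist X] (c : ℝ → X) (l : ℝ) : Prop :=
  0 ≤ l ∧ ∀ s ∈ Icc 0 l, ∀ t ∈ Icc 0 l, dist (c s) (c t) = |s - t|

/-- Any two points are the endpoints of a geodesic. -/
def IsGeodesicSpace (X : Type u) [Dist X] : Prop :=
  ∀ x y : X, ∃ (c : ℝ → X) (l : ℝ), IsGeodesicOn c l ∧ c 0 = x ∧ c l = y

/-- A subset is convex if it contains every geodesic whose endpoints it contains. -/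
def IsGeodesicallyConvex {X : Type u} [Dist X] (D : Set X) : Prop :=
  ∀ (c : ℝ → X) (l : ℝ), IsGeodesicOn c l → c 0 ∈ D → c l ∈ D → ∀ t ∈ Icc 0 l, c t ∈ D

/-- A metric space is CAT(0) if it is geodesic and every geodesic triangle is thinner than its
comparison triangle in the Euclidean plane. Here `c₁`, `c₂` are two sides `[x, y]`, `[x, z]` issuing
from the same vertex, `x' y' z'` is a comparison triangle, and the points at the fractions `s`, `t`
of the two sides are compared with the corresponding points of the comparison triangle. -/
def IsCATZero (X : Type u) [MetricSpace X] : Prop :=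
  IsGeodesicSpace X ∧
  ∀ (c₁ c₂ : ℝ → X) (a b : ℝ), IsGeodesicOn c₁ a → IsGeodesicOn c₂ b → c₁ 0 = c₂ 0 →
    ∀ x' y' z' : EuclideanSpace ℝ (Fin 2),
      dist x' y' = a → dist x' z' = b → dist y' z' = dist (c₁ a) (c₂ b) →
      ∀ s ∈ Icc (0 : ℝ) 1, ∀ t ∈ Icc (0 : ℝ) 1,
        dist (c₁ (s * a)) (c₂ (t * b)) ≤
          dist (AffineMap.lineMap x' y' s) (AffineMap.lineMap x' z' t)

/-! ### Alexandrov angles, spaces of directions and geometric dimension -/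

/-- A nondegenerate geodesic segment starting from `x`. -/
structure GeodesicFrom {X : Type u} [Dist X] (x : X) where
  path : ℝ → X
  length : ℝ
  length_pos : 0 < length
  isGeodesic : IsGeodesicOn path length
  source : path 0 = x

/-- The angle at `p` in a Euclidean comparison triangle for `p`, `q`, `r` (law of cosines). -/
def comparisonAngle {X : Type u} [Dist X] (p q r : X) : ℝ :=
  Real.arccos ((dist p q ^ 2 + dist p r ^ 2 - dist q r ^ 2) / (2 * dist p q * dist p r))

/-- The Alexandrov angle at `x` between two geodesic segments starting from `x`: the upper limit of
the comparison angles as the parameters tend to `0` from the right. -/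
def angle {X : Type u} [Dist X] {x : X} (c c' : GeodesicFrom x) : ℝ :=
  limsup (fun p : ℝ × ℝ => comparisonAngle x (c.path p.1) (c'.path p.2)) (𝓝[>] 0 ×ˢ 𝓝[>] 0)

/-- The space of directions at `x`: geodesic segments starting from `x`, where two segments making
a zero angle are identified. -/
def SpaceOfDirections {X : Type u} [Dist X] (x : X) : Type u :=
  Quot (fun c c' : GeodesicFrom x => angle c c' = 0)

/-- The angle metric on the space of directions. The angle does not depend on the representatives,
so the infimum is over a set with a single element. -/
instance {X : Type u} [Dist X] (x : X) : Dist (SpaceOfDirections x) where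
  dist v w := sInf {θ : ℝ | ∃ c c' : GeodesicFrom x,
    (Quot.mk _ c : SpaceOfDirections x) = v ∧ (Quot.mk _ c' : SpaceOfDirections x) = w ∧
      θ = angle c c'}

/-- Every point is isolated. -/
def IsDiscreteSpace (X : Type u) [Dist X] : Prop :=
  ∀ x : X, ∃ ε > 0, ∀ y : X, dist x y < ε → y = x

/-- Geometric dimension at most `n`: at most `0` means discrete, and at most `n + 1` means that all
spaces of directions have geometric dimension at most `n`. -/
def HasGeometricDimensionLE : ℕ → (X : Type u) → [Dist X] → Prop
  | 0, X, _ => IsDiscreteSpace X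
  | n + 1, X, _ => ∀ x : X, HasGeometricDimensionLE n (SpaceOfDirections x)

/-- The geometric dimension `GD(X)`, i.e. `0` if `X` is discrete and `1 + sup_x GD(Σ_x X)`
otherwise (possibly infinite). -/
def geometricDimension (X : Type u) [Dist X] : ℕ∞ :=
  ⨅ (n : ℕ) (_ : HasGeometricDimensionLE n X), (n : ℕ∞)

/-! ### Isometries -/

/-- The translation length `ℓ(g) = inf_x d(x, g x)`. -/
def translationLength {X : Type u} [MetricSpace X] (g : X ≃ᵢ X) : ℝ :=
  ⨅ x : X, dist x (g x)

/-- The infimum in the translation length is attained. -/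
def IsSemisimple {X : Type u} [MetricSpace X] (g : X ≃ᵢ X) : Prop :=
  ∃ x : X, dist x (g x) = translationLength g

/-- The infimum is attained and equal to `0`. -/
def IsElliptic {X : Type u} [MetricSpace X] (g : X ≃ᵢ X) : Prop :=
  IsSemisimple g ∧ translationLength g = 0

/-- The infimum is attained and nonzero. -/
def IsHyperbolic {X : Type u} [MetricSpace X] (g : X ≃ᵢ X) : Prop :=
  IsSemisimple g ∧ translationLength g ≠ 0

/-- The infimum is not attained. -/
def IsParabolic {X : Type u} [MetricSpace X] (g : X ≃ᵢ X) : Prop :=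
  ¬ IsSemisimple g

/-- A group of isometries is discrete if for all `x` and `η ≥ 0` only finitely many of its elements
move `x` by less than `η`. -/
def IsDiscreteGroup {X : Type u} [MetricSpace X] (Γ : Subgroup (X ≃ᵢ X)) : Prop :=
  ∀ (x : X) (η : ℝ), 0 ≤ η → {g : X ≃ᵢ X | g ∈ Γ ∧ dist x (g x) < η}.Finite

/-! ### Groups -/

/-- A group is virtually abelian if it has an abelian subgroup of finite index. -/
def IsVirtuallyAbelian (G : Type u) [Group G] : Prop :=
  ∃ A : Subgroup G, (∀ a ∈ A, ∀ b ∈ A, a * b = b * a) ∧ A.FiniteIndex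

/-- The subgroup `H` is the internal direct product of its subgroups `A` and `B`. -/
def IsInternalDirectProduct {G : Type u} [Group G] (H A B : Subgroup G) : Prop :=
  (∀ a ∈ A, ∀ b ∈ B, a * b = b * a) ∧ A ⊓ B = ⊥ ∧ A ⊔ B = H

/-- The Euclidean space `ℝᵏ`. -/
abbrev E (k : ℕ) : Type := EuclideanSpace ℝ (Fin k)

end CATZero

end

noncomputable section

namespace CATZero

/-! ### Finitely generated nilpotent groups -/

section Nilpotent

open Subgroup
open scoped commutatorElement

/-! A finitely generated virtually nilpotent group has a normal nilpotent torsion-free subgroup `N`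
of finite index (`exists_normal_nilpotent_torsionFree`). The key observation is that semisimple
elements of `N` are central in `N` (`semisimple_central`). Otherwise nilpotency yields commuting
semisimple `h` and `z ≠ 1` for which every `h * z ^ n` is conjugate to `h`. All these products then
have the same translation length, whereas on a common minimal set of `h` and `z` the displacement
grows linearly in `n` unless `z` has a fixed point. A fixed point makes `z` torsion by discreteness,
so `z = 1`.

Hence the semisimple elements of `N` form a subgroup `A ≅ ℤᵏ`, normal in `Γ`. By the flat torus
theorem (`exists_invariant_splitting`) the common minimal set of `A` is a `Γ`-invariant product `W ×
ℝᵏ`. On it `A` is a lattice of translations of `ℝᵏ`, and `N`, which centralizes `A`, acts on `ℝᵏ` by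
translations. The displacement of `γ ∈ N` on the product is thus its displacement on `W` plus a
constant in the sense of Pythagoras, so `γ` is semisimple on `X` as soon as its component on `W` is.
Such a `γ` lies in `A` and is trivial on `W`. This excludes hyperbolic components, first on `N` and
then, by taking powers, on `Γ`.

Projecting the translation parts of `N` to the rational span of the lattice gives a virtual
complement of `A` (`exists_virtual_splitting`), which serves as `Γ_W`; the semisimple elements of
`H` are exactly `A`. Without parabolics `N = A` is abelian.

The geometry rests on the Bruhat–Tits inequality alone: it gives unique geodesics, projections and
the four-point inequality `dist_sq_add_dist_sq_le`, and, for translations, the parallelogram law and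
an affine height function whose zero set is the factor `W`. -/

theorem subgroup_fg_of_map_of_inf_ker {G Q : Type*} [Group G] [Group Q] (f : G →* Q)
    (H : Subgroup G) (h₁ : (H.map f).FG) (h₂ : (H ⊓ f.ker).FG) : H.FG := by
  classical
  obtain ⟨S, hS⟩ := h₁
  have hmem : ∀ q ∈ S, ∃ g ∈ H, f g = q := fun q hq => by
    have : q ∈ H.map f := hS ▸ subset_closure hq
    simpa using this
  choose! r hrH hr using hmem
  have hcl : closure (S.image r : Set G) ≤ H := by
    rw [closure_le]
    intro x hx
    obtain ⟨q, hq, rfl⟩ := Finset.mem_image.1 hx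
    exact hrH q hq
  have : H = closure (S.image r : Set G) ⊔ (H ⊓ f.ker) := by
    apply le_antisymm
    · intro h hh
      have h1 : f h ∈ (closure (S.image r : Set G)).map f := by
        rw [MonoidHom.map_closure]
        have : f '' (S.image r : Set G) = S := by
          ext q
          simp only [Finset.coe_image, Set.mem_image, Finset.mem_coe]
          constructor
          · rintro ⟨_, ⟨q', hq', rfl⟩, rfl⟩
            rwa [hr q' hq']
          · intro hq
            exact ⟨_, ⟨q, hq, rfl⟩, hr q hq⟩
        rw [this, hS]
        exact mem_map_of_mem f hh
      obtain ⟨g, hg, hgh⟩ := h1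
      have : h = g * (g⁻¹ * h) := by group
      rw [this]
      refine mul_mem_sup hg (mem_inf.2 ⟨mul_mem (inv_mem (hcl hg)) hh, ?_⟩)
      rw [MonoidHom.mem_ker, map_mul, map_inv, hgh, inv_mul_cancel]
    · exact sup_le hcl inf_le_left
  rw [this]
  exact FG.sup ⟨_, rfl⟩ h₂

theorem subgroup_fg_of_commGroup {A : Type*} [CommGroup A] [Group.FG A] (B : Subgroup A) :
    B.FG := by
  rw [Subgroup.fg_iff_add_fg]
  have : Module.Finite ℤ (Additive A) :=
    Module.Finite.iff_addGroup_fg.mpr inferInstance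
  have h := IsNoetherian.noetherian (AddSubgroup.toIntSubmodule B.toAddSubgroup)
  rw [Submodule.fg_iff_addSubgroup_fg] at h
  simpa using h

theorem subgroup_fg_map {G Q : Type*} [Group G] [Group Q] {H : Subgroup G} (h : H.FG)
    (f : G →* Q) : (H.map f).FG := by
  rw [Subgroup.fg_iff_submonoid_fg] at h ⊢
  exact h.map f

theorem subgroup_fg_of_le_of_le_center {G : Type*} [Group G] {K H : Subgroup G} (hK : K.FG)
    (hKc : K ≤ center G) (hH : H ≤ K) : H.FG := by
  let _ : CommGroup K :=
    { (inferInstance : Group K) with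
      mul_comm := fun a b => Subtype.ext ((mem_center_iff.1 (hKc a.2) (b : G)).symm) }
  have : Group.FG K := (Group.fg_iff_subgroup_fg K).2 hK
  have h := subgroup_fg_of_commGroup (H.subgroupOf K)
  have h2 := subgroup_fg_map h K.subtype
  rwa [map_subgroupOf_eq_of_le hH] at h2

/-- When `⁅M, ⊤⁆` is central the commutator is bimultiplicative, so the finitely many commutators of
generators of `M` modulo `⁅M, ⊤⁆` with generators of `G` suffice. Equivalently, modulo the subgroup
`L` they generate, both the lifted generators and `⁅M, ⊤⁆` are central, hence so is `M`. -/
theorem commutator_top_fg {G : Type*} [Group G] [Group.FG G] (M : Subgroup G) [M.Normal]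
    (hc : ⁅M, (⊤ : Subgroup G)⁆ ≤ center G)
    (hM : (M.map (QuotientGroup.mk' ⁅M, (⊤ : Subgroup G)⁆)).FG) :
    ⁅M, (⊤ : Subgroup G)⁆.FG := by
  classical
  set K := ⁅M, (⊤ : Subgroup G)⁆ with hK
  obtain ⟨T, hT⟩ := Group.fg_def.1 (inferInstance : Group.FG G)
  obtain ⟨S, hS⟩ := hM
  have hmem : ∀ q ∈ S, ∃ g ∈ M, QuotientGroup.mk' K g = q := fun q hq => by
    have : q ∈ M.map (QuotientGroup.mk' K) := hS ▸ subset_closure hq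
    simpa using this
  choose! r hrH hr using hmem
  set F : Finset G := (S ×ˢ T).image fun p => ⁅r p.1, p.2⁆ with hF
  have hFK : closure (F : Set G) ≤ K := by
    rw [closure_le]
    intro x hx
    obtain ⟨p, hp, rfl⟩ := Finset.mem_image.1 hx
    exact commutator_mem_commutator (hrH _ (Finset.mem_product.1 hp).1) (mem_top _)
  set L := closure (F : Set G) with hL
  have hLc : L ≤ center G := hFK.trans hc
  have : L.Normal := ⟨fun n hn g => by
    have := mem_center_iff.1 (hLc hn) g
    rw [this, mul_inv_cancel_right]; exact hn⟩
  refine ⟨F, le_antisymm hFK ?_⟩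
  -- elements of `M` are central modulo `L`
  set Z := (center (G ⧸ L)).comap (QuotientGroup.mk' L) with hZ
  have hSZ : ∀ q ∈ S, r q ∈ Z := by
    intro q hq
    have hle : (⊤ : Subgroup G) ≤ (centralizer {QuotientGroup.mk' L (r q)}).comap
        (QuotientGroup.mk' L) := by
      rw [← hT, closure_le]
      intro t ht
      simp only [coe_comap, Set.mem_preimage, SetLike.mem_coe, mem_centralizer_singleton_iff]
      rw [← map_mul, ← map_mul]
      apply QuotientGroup.eq.2
      have : ⁅r q, t⁆ ∈ L := subset_closure (Finset.mem_image.2 ⟨(q, t), Finset.mem_product.2 ⟨hq, ht⟩, rfl⟩)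
      have h3 := mem_center_iff.1 (hLc this) (t * r q)
      have h4 : (t * r q)⁻¹ * (r q * t) = ⁅r q, t⁆ := by
        have : r q * t = ⁅r q, t⁆ * (t * r q) := by rw [commutatorElement_def]; group
        rw [this, ← h3]; group
      rw [h4]; exact this
    rw [hZ, mem_comap, mem_center_iff]
    intro g
    obtain ⟨g, rfl⟩ := QuotientGroup.mk'_surjective L g
    have := hle (mem_top g)
    rw [mem_comap, mem_centralizer_singleton_iff] at this
    exact this
  have hKZ : K ≤ Z := fun k hk => by
    rw [hZ, mem_comap, mem_center_iff]
    intro g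
    obtain ⟨g, rfl⟩ := QuotientGroup.mk'_surjective L g
    rw [← map_mul, ← map_mul, mem_center_iff.1 (hc hk) g]
  have hMZ : M ≤ Z := by
    intro m hm
    have h1 : QuotientGroup.mk' K m ∈ (closure (S.image r : Set G)).map (QuotientGroup.mk' K) := by
      rw [MonoidHom.map_closure]
      have : QuotientGroup.mk' K '' (S.image r : Set G) = S := by
        ext q
        simp only [Finset.coe_image, Set.mem_image, Finset.mem_coe]
        constructor
        · rintro ⟨_, ⟨q', hq', rfl⟩, rfl⟩
          rwa [hr q' hq']
        · intro hq
          exact ⟨_, ⟨q, hq, rfl⟩, hr q hq⟩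
      rw [this, hS]
      exact mem_map_of_mem _ hm
    obtain ⟨g, hg, hgh⟩ := h1
    have hgZ : g ∈ Z := by
      have : closure (S.image r : Set G) ≤ Z := by
        rw [closure_le]
        intro x hx
        obtain ⟨q, hq, rfl⟩ := Finset.mem_image.1 hx
        exact hSZ q hq
      exact this hg
    have : g⁻¹ * m ∈ K := QuotientGroup.eq.1 hgh
    have : m = g * (g⁻¹ * m) := by group
    rw [this]
    exact mul_mem hgZ (hKZ ‹_›)
  rw [hK, commutator_le]
  intro m hm g _
  have := mem_center_iff.1 (mem_comap.1 (hMZ hm)) (QuotientGroup.mk' L g)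
  rw [← map_mul, ← map_mul] at this
  have h5 : (m * g)⁻¹ * (g * m) ∈ L := QuotientGroup.eq.1 this.symm
  have h6 := mem_center_iff.1 (hLc h5) (m * g)
  have h7 : ⁅m, g⁆ = ((m * g)⁻¹ * (g * m))⁻¹ := by
    have h8 : g * m = (m * g)⁻¹ * (g * m) * (m * g) := by rw [← h6]; group
    rw [commutatorElement_def]
    have : m * g * m⁻¹ * g⁻¹ = (m * g) * (g * m)⁻¹ := by group
    rw [this]
    nth_rewrite 1 [h8]
    group
  rw [h7]
  exact inv_mem h5

/-- Induction on the class. The last term of the lower central series is central, and it is finitely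
generated by `commutator_top_fg`, whose hypothesis holds in the quotient by induction; subgroups are
then extensions of finitely generated groups. -/
theorem subgroup_fg_of_lowerCentralSeries_eq_bot (c : ℕ) :
    ∀ (G : Type u) [Group G] [Group.FG G], Subgroup.lowerCentralSeries (⊤ : Subgroup G) c = ⊥ →
      ∀ H : Subgroup G, H.FG := by
  induction c with
  | zero =>
    intro G _ _ h H
    have h' : (⊤ : Subgroup G) = ⊥ := h
    have : H = ⊥ := le_bot_iff.1 (h' ▸ le_top)
    rw [this]; exact FG.bot
  | succ c ih =>
    intro G _ _ h H
    set K := Subgroup.lowerCentralSeries (⊤ : Subgroup G) c with hK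
    have hKc : K ≤ center G := by
      intro x hx
      rw [mem_center_iff]
      intro g
      have : ⁅x, g⁆ ∈ (⊥ : Subgroup G) := h ▸ commutator_mem_commutator hx (mem_top g)
      exact (commutatorElement_eq_one_iff_mul_comm.1 (mem_bot.1 this)).symm
    have hq : Subgroup.lowerCentralSeries (⊤ : Subgroup (G ⧸ K)) c = ⊥ := by
      have := map_lowerCentralSeries (⊤ : Subgroup G) (QuotientGroup.mk' K) c
      rw [← hK, Subgroup.map_top_of_surjective _ (QuotientGroup.mk'_surjective K)] at this
      rw [← this, eq_bot_iff]
      rintro _ ⟨x, hx, rfl⟩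
      exact mem_bot.2 ((QuotientGroup.eq_one_iff x).2 hx)
    have hP := ih (G ⧸ K) hq
    have hKfg : K.FG := by
      cases c with
      | zero => exact Group.fg_def.1 (inferInstance : Group.FG G)
      | succ d => exact commutator_top_fg (Subgroup.lowerCentralSeries ⊤ d) hKc (hP _)
    refine subgroup_fg_of_map_of_inf_ker (QuotientGroup.mk' K) H (hP _) ?_
    refine subgroup_fg_of_le_of_le_center hKfg hKc ?_
    rw [QuotientGroup.ker_mk']
    exact inf_le_right

theorem subgroup_fg_of_isNilpotent {G : Type u} [Group G] [Group.FG G] [hG : Group.IsNilpotent G]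
    (H : Subgroup G) : H.FG := by
  obtain ⟨c, hc⟩ := Subgroup.nilpotent_iff_lowerCentralSeries.1 hG
  exact subgroup_fg_of_lowerCentralSeries_eq_bot c G hc H

/-! ### Residual finiteness and torsion-free subgroups of finite index -/

@[reducible]
def centerCommGroup (G : Type*) [Group G] : CommGroup (center G) :=
  { (inferInstance : Group (center G)) with
    mul_comm := fun a b => Subtype.ext ((mem_center_iff.1 a.2 (b : G)).symm) }

attribute [local instance] centerCommGroup

/-- Conjugation by `g` multiplies `x` by a central `z`, hence multiplies `x ^ e` by `z ^ e = 1`. An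
exponent of the centre is therefore an exponent of the next step of the upper central series. -/
theorem pow_card_center_mem_center {G : Type*} [Group G] (e : ℕ)
    (he : ∀ z ∈ center G, z ^ e = 1) (x : G)
    (hx : (QuotientGroup.mk' (center G) x) ∈ center (G ⧸ center G)) : x ^ e ∈ center G := by
  rw [mem_center_iff]
  intro g
  have h1 := mem_center_iff.1 hx (QuotientGroup.mk' (center G) g)
  rw [← map_mul, ← map_mul] at h1
  have h2 : (x * g)⁻¹ * (g * x) ∈ center G := QuotientGroup.eq.1 h1.symm
  set z := (x * g)⁻¹ * (g * x) with hz
  have h3 : g * x * g⁻¹ = x * z := by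
    have : g * x = (x * g) * z := by rw [hz]; group
    rw [this, mul_assoc x g z, mem_center_iff.1 h2 g]; group
  have h4 : Commute x z := mem_center_iff.1 h2 x
  have h5 : (g * x * g⁻¹) ^ e = x ^ e := by
    rw [h3, h4.mul_pow, he z h2, mul_one]
  rw [conj_pow] at h5
  calc g * x ^ e = g * x ^ e * g⁻¹ * g := by group
    _ = x ^ e * g := by rw [h5]

theorem finite_of_center_isOfFinOrder (G : Type u) [Group G] [Group.IsNilpotent G] :
    Group.FG G → (∀ z ∈ center G, IsOfFinOrder z) → Finite G := by
  refine Group.nilpotent_center_quotient_ind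
    (P := fun G _ _ => Group.FG G → (∀ z ∈ center G, IsOfFinOrder z) → Finite G) G ?_ ?_
  · intro G _ _ _ _
    infer_instance
  · intro G _ _ ih hfg htor
    have hZ : Group.FG (center G) := (Group.fg_iff_subgroup_fg _).2 (subgroup_fg_of_isNilpotent _)
    have hfin : Finite (center G) := by
      apply CommGroup.finite_of_fg_isMulTorsion
      intro z
      exact Submonoid.isOfFinOrder_coe.1 ((htor z z.2 : IsOfFinOrder (z : G)))
    have he : ∀ z ∈ center G, z ^ Nat.card (center G) = 1 := by
      intro z hz
      have := pow_card_eq_one' (G := center G) (x := ⟨z, hz⟩)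
      exact congrArg Subtype.val this
    have hq : Finite (G ⧸ center G) := by
      apply ih inferInstance
      intro z hz
      obtain ⟨x, rfl⟩ := QuotientGroup.mk'_surjective _ z
      have := pow_card_center_mem_center _ he x hz
      rw [isOfFinOrder_iff_pow_eq_one]
      refine ⟨Nat.card (center G), Nat.card_pos, ?_⟩
      rw [← map_pow]
      exact (QuotientGroup.eq_one_iff _).2 this
    rw [finite_iff_finite_and_finiteIndex (H := center G)]
    exact ⟨hfin, finiteIndex_of_finite_quotient⟩

/-- Residual finiteness. Take `M` maximal among the normal subgroups avoiding `f`. Every nontrivial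
normal subgroup of `G ⧸ M` contains the image of `f`, which forces the centre of `G ⧸ M` to be
torsion and so `G ⧸ M` to be finite. -/
theorem exists_finiteIndex_notMem {G : Type u} [Group G] [Group.IsNilpotent G] [Group.FG G]
    (f : G) (hf : f ≠ 1) : ∃ M : Subgroup G, M.FiniteIndex ∧ f ∉ M := by
  obtain ⟨M, -, hM⟩ := zorn_le_nonempty₀ {M : Subgroup G | M.Normal ∧ f ∉ M} (by
    intro c hc hch y hy
    have hdir : DirectedOn (· ≤ ·) c := hch.directedOn
    refine ⟨sSup c, ⟨⟨fun n hn g => ?_⟩, fun hfc => ?_⟩, fun z hz => le_sSup hz⟩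
    · obtain ⟨s, hs, hns⟩ := (mem_sSup_of_directedOn ⟨y, hy⟩ hdir).1 hn
      exact (mem_sSup_of_directedOn ⟨y, hy⟩ hdir).2 ⟨s, hs, (hc hs).1.conj_mem n hns g⟩
    · obtain ⟨s, hs, hns⟩ := (mem_sSup_of_directedOn ⟨y, hy⟩ hdir).1 hfc
      exact (hc hs).2 hns) ⊥ ⟨inferInstance, fun h => hf (mem_bot.1 h)⟩
  obtain ⟨⟨hMn, hfM⟩, hmax⟩ := hM
  have key : ∀ K : Subgroup (G ⧸ M), K.Normal → K ≠ ⊥ → QuotientGroup.mk' M f ∈ K := by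
    intro K hK hne
    by_contra hfK
    have hle : M ≤ K.comap (QuotientGroup.mk' M) := by
      intro m hm
      rw [mem_comap, (show QuotientGroup.mk' M m = 1 from (QuotientGroup.eq_one_iff m).2 hm)]
      exact one_mem K
    have := hmax (y := K.comap (QuotientGroup.mk' M)) ⟨hK.comap _, fun h => hfK h⟩ hle
    apply hne
    rw [eq_bot_iff]
    intro k hk
    obtain ⟨x, rfl⟩ := QuotientGroup.mk'_surjective M k
    exact mem_bot.2 ((QuotientGroup.eq_one_iff x).2 (this hk))
  have hcen : ∀ z ∈ center (G ⧸ M), z ≠ 1 → QuotientGroup.mk' M f ∈ zpowers z := by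
    intro z hz hz1
    apply key
    · refine ⟨fun n hn g => ?_⟩
      have : n ∈ center (G ⧸ M) := (zpowers_le.2 hz) hn
      rw [mem_center_iff.1 this g, mul_inv_cancel_right]
      exact hn
    · rwa [Ne, zpowers_eq_bot]
  have hf1 : QuotientGroup.mk' M f ≠ 1 := fun h => hfM ((QuotientGroup.eq_one_iff f).1 h)
  refine ⟨M, ?_, hfM⟩
  rw [finiteIndex_iff_finite_quotient]
  apply finite_of_center_isOfFinOrder (G ⧸ M) inferInstance
  intro z hz
  rcases eq_or_ne z 1 with rfl | hz1
  · exact IsOfFinOrder.one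
  by_contra hzo
  obtain ⟨n, hn⟩ := mem_zpowers_iff.1 (hcen z hz hz1)
  have hn0 : n ≠ 0 := by
    rintro rfl
    exact hf1 (by rw [← hn, zpow_zero])
  have hinj := injective_zpow_iff_not_isOfFinOrder.2 hzo
  -- The image `z ^ n` of `f` would also be a power of `z ^ (2 * n)`, which is impossible for `z` of
  -- infinite order and `n ≠ 0`.
  have h2 : z ^ (2 * n) ≠ 1 := by
    intro h
    have := hinj (a₁ := 2 * n) (a₂ := 0) (by simpa using h)
    omega
  obtain ⟨m, hm⟩ := mem_zpowers_iff.1 (hcen _ (zpow_mem hz (2 * n)) h2)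
  rw [← zpow_mul, ← hn] at hm
  have := hinj hm
  have h3 : n * (2 * m - 1) = 0 := by linarith
  rcases mul_eq_zero.1 h3 with h | h
  · exact hn0 h
  · omega

/-- By induction on the quotient by the centre, torsion can be pushed into the centre. The torsion
of the centre is finite, and residual finiteness excludes its nontrivial elements one at a time. -/
theorem exists_finiteIndex_torsionFree (G : Type u) [Group G] [Group.IsNilpotent G] :
    Group.FG G → ∃ M : Subgroup G, M.FiniteIndex ∧ ∀ x ∈ M, IsOfFinOrder x → x = 1 := by
  refine Group.nilpotent_center_quotient_ind
    (P := fun G _ _ => Group.FG G →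
      ∃ M : Subgroup G, M.FiniteIndex ∧ ∀ x ∈ M, IsOfFinOrder x → x = 1) G ?_ ?_
  · intro G _ _ _
    exact ⟨⊤, inferInstance, fun x _ _ => Subsingleton.elim _ _⟩
  · intro G _ _ ih hfg
    obtain ⟨M₁, hM₁, htf⟩ := ih inferInstance
    have hZ : Group.FG (center G) := (Group.fg_iff_subgroup_fg _).2 (subgroup_fg_of_isNilpotent _)
    have hTfg : Group.FG (CommGroup.torsion (center G)) :=
      (Group.fg_iff_subgroup_fg _).2 (subgroup_fg_of_commGroup _)
    have hTfin : Finite (CommGroup.torsion (center G)) :=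
      CommGroup.finite_of_fg_isMulTorsion _ fun z => Submonoid.isOfFinOrder_coe.1 z.2
    have hex : ∀ t : CommGroup.torsion (center G), ∃ M : Subgroup G, M.FiniteIndex ∧
        (((t : center G) : G) ∈ M → ((t : center G) : G) = 1) := by
      intro t
      by_cases ht : ((t : center G) : G) = 1
      · exact ⟨⊤, inferInstance, fun _ => ht⟩
      · obtain ⟨M, hM, hn⟩ := exists_finiteIndex_notMem _ ht
        exact ⟨M, hM, fun h => absurd h hn⟩
    choose Mt hMt hMt' using hex
    have := finiteIndex_iInf hMt
    have hM₁' : (M₁.comap (QuotientGroup.mk' (center G))).FiniteIndex := by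
      rw [finiteIndex_iff, index_comap_of_surjective _ (QuotientGroup.mk'_surjective _)]
      exact hM₁.index_ne_zero
    refine ⟨M₁.comap (QuotientGroup.mk' (center G)) ⊓ ⨅ t, Mt t, inferInstance, ?_⟩
    rintro x ⟨hx1, hx2⟩ hxo
    have hxZ : x ∈ center G := by
      have := htf _ hx1 (MonoidHom.isOfFinOrder _ hxo)
      exact (QuotientGroup.eq_one_iff x).1 this
    exact hMt' ⟨⟨x, hxZ⟩, Submonoid.isOfFinOrder_coe.1 hxo⟩ (mem_iInf.1 hx2 _)

theorem isNilpotent_of_le {G : Type*} [Group G] {K H : Subgroup G} (hKH : K ≤ H)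
    (hH : Group.IsNilpotent H) : Group.IsNilpotent K := by
  apply Subgroup.isNilpotent_of_ker_le_center (inclusion hKH)
  rw [(MonoidHom.ker_eq_bot_iff _).2 (inclusion_injective hKH)]
  exact bot_le

theorem exists_normal_nilpotent_torsionFree {G : Type u} [Group G] [Group.FG G]
    (hG : Group.IsVirtuallyNilpotent G) :
    ∃ N : Subgroup G, N.Normal ∧ N.FiniteIndex ∧ Group.IsNilpotent N ∧
      ∀ x ∈ N, IsOfFinOrder x → x = 1 := by
  obtain ⟨N₀, hnil, hfin⟩ := hG
  have hfg : Group.FG N₀ := inferInstance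
  obtain ⟨M, hM, htf⟩ := exists_finiteIndex_torsionFree N₀ hfg
  have hle : M.map N₀.subtype ≤ N₀ := map_subtype_le M
  have hMf : (M.map N₀.subtype).FiniteIndex := by
    rw [finiteIndex_iff, index_map_subtype]
    exact mul_ne_zero hM.index_ne_zero hfin.index_ne_zero
  refine ⟨(M.map N₀.subtype).normalCore, inferInstance, inferInstance,
    isNilpotent_of_le ((normalCore_le _).trans hle) hnil, fun x hx hxo => ?_⟩
  obtain ⟨y, hy, rfl⟩ := normalCore_le _ hx
  rw [htf y hy (Submonoid.isOfFinOrder_coe.1 hxo), map_one]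

/-- In a nilpotent group, a conjugation invariant set that is closed under inverses and under
products of commuting elements is central, provided that it contains no `z ≠ 1` commuting with
some `h` in the set such that all `h * z ^ n` are conjugate to `h`. -/
theorem subset_center_of_isNilpotent {N : Type*} [Group N] [hN : Group.IsNilpotent N] (S : Set N)
    (hconj : ∀ g ∈ S, ∀ c, c * g * c⁻¹ ∈ S) (hinv : ∀ g ∈ S, g⁻¹ ∈ S)
    (hmul : ∀ g ∈ S, ∀ h ∈ S, Commute g h → g * h ∈ S)
    (hz : ∀ h ∈ S, ∀ z ∈ S, Commute h z → (∀ n : ℕ, ∃ c, c * h * c⁻¹ = h * z ^ n) → z = 1)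
    (g : N) (hg : g ∈ S) : g ∈ center N := by
  set C : Subgroup N := centralizer {g} with hC
  have hgC : g ∈ C := by simp [hC, mem_centralizer_singleton_iff]
  by_contra hgc
  have hCtop : C < ⊤ := by
    rw [lt_top_iff_ne_top]
    intro h
    apply hgc
    rw [mem_center_iff]
    intro x
    have : x ∈ C := h ▸ mem_top x
    exact mem_centralizer_singleton_iff.1 this
  -- Let `c` normalize the centralizer `C` of `g` without lying in it. Iterated commutators with
  -- `c`, starting from `g`, stay in `S` and in the centre of `C`, and descend the lower central
  -- series.
  obtain ⟨c, hcn, hcC⟩ := SetLike.exists_of_lt (Group.normalizerCondition_of_isNilpotent C hCtop)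
  rw [mem_normalizer_iff] at hcn
  set δ : N → N := fun d => c * d * c⁻¹ * d⁻¹ with hδ
  have hQ : ∀ j : ℕ, δ^[j] g ∈ S ∧ δ^[j] g ∈ C ∧ ∀ x ∈ C, Commute (δ^[j] g) x := by
    intro j
    induction j with
    | zero =>
      exact ⟨hg, hgC, fun x hx => (mem_centralizer_singleton_iff.1 hx).symm⟩
    | succ j ih =>
      obtain ⟨h1, h2, h3⟩ := ih
      rw [Function.iterate_succ_apply']
      set d := δ^[j] g
      have hc2 : c * d * c⁻¹ ∈ C := (hcn d).1 h2
      have hc3 : ∀ x ∈ C, Commute (c * d * c⁻¹) x := by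
        intro x hx
        have hx' : c⁻¹ * x * c ∈ C := by
          rw [hcn]
          convert hx using 1
          group
        have h4 : d * (c⁻¹ * x * c) = (c⁻¹ * x * c) * d := h3 _ hx'
        change c * d * c⁻¹ * x = x * (c * d * c⁻¹)
        calc c * d * c⁻¹ * x = c * (d * (c⁻¹ * x * c)) * c⁻¹ := by group
          _ = x * (c * d * c⁻¹) := by rw [h4]; group
      refine ⟨hmul _ (hconj _ h1 c) _ (hinv _ h1) (hc3 _ (inv_mem h2)), mul_mem hc2 (inv_mem h2),
        fun x hx => (hc3 x hx).mul_left (h3 x hx).inv_left⟩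
  have hlow : ∀ j : ℕ, δ^[j] g ∈ Subgroup.lowerCentralSeries (⊤ : Subgroup N) j := by
    intro j
    induction j with
    | zero => exact mem_top g
    | succ j ih =>
      rw [Function.iterate_succ_apply', Subgroup.lowerCentralSeries_succ, commutator_comm]
      exact commutator_mem_commutator (mem_top c) ih
  obtain ⟨m, hm⟩ := Subgroup.nilpotent_iff_lowerCentralSeries.1 hN
  have hex : ∃ j, δ^[j] g = 1 := ⟨m, mem_bot.1 (hm ▸ hlow m)⟩
  classical
  have hspec := Nat.find_spec hex
  have hmin := fun k => Nat.find_min hex (m := k)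
  set j := Nat.find hex
  have hg1 : g ≠ 1 := fun h => hgc (h ▸ one_mem _)
  have hj0 : j ≠ 0 := by
    intro h
    rw [h] at hspec
    exact hg1 hspec
  have hj1 : j ≠ 1 := by
    intro h
    rw [h] at hspec
    apply hcC
    rw [hC, mem_centralizer_singleton_iff]
    have : c * g * c⁻¹ * g⁻¹ = 1 := hspec
    calc c * g = (c * g * c⁻¹ * g⁻¹) * (g * c) := by group
      _ = g * c := by rw [this, one_mul]
  -- The last two nontrivial iterates are `h` and `z`: `c` conjugates `h` to `h * z` and commutes
  -- with `z`, so `c ^ n` conjugates `h` to `h * z ^ n`. At least two exist because `g ≠ 1` and `c`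
  -- does not commute with `g`.
  obtain ⟨i, hi⟩ : ∃ i, j = i + 1 + 1 := ⟨j - 2, by omega⟩
  have hz1 : δ^[i + 1] g ≠ 1 := hmin _ (by omega)
  apply hz1
  obtain ⟨hhS, hhC, hhc⟩ := hQ i
  obtain ⟨hzS, hzC, hzc⟩ := hQ (i + 1)
  rw [hi, Function.iterate_succ_apply'] at hspec
  have hzh : δ^[i + 1] g = δ (δ^[i] g) := Function.iterate_succ_apply' _ _ _
  set h := δ^[i] g
  set z := δ^[i + 1] g
  have e1 : c * z * c⁻¹ = z := mul_inv_eq_one.1 hspec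
  have hcomm : Commute h z := hhc z hzC
  have e2 : c * h * c⁻¹ = h * z := by
    have : z = c * h * c⁻¹ * h⁻¹ := hzh
    rw [hcomm.eq, this]; group
  refine hz h hhS z hzS hcomm fun n => ⟨c ^ n, ?_⟩
  induction n with
  | zero => simp
  | succ n ihn =>
    have : c ^ (n + 1) * h * (c ^ (n + 1))⁻¹ = c * (c ^ n * h * (c ^ n)⁻¹) * c⁻¹ := by
      rw [pow_succ']; group
    rw [this, ihn]
    calc c * (h * z ^ n) * c⁻¹ = (c * h * c⁻¹) * (c * z ^ n * c⁻¹) := by group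
      _ = h * z * z ^ n := by rw [← conj_pow, e1, e2]
      _ = h * z ^ (n + 1) := by rw [pow_succ', mul_assoc]

/-! ### Virtual complements of a central subgroup -/

theorem exists_nsmul_mem_of_mem_span {V : Type*} [AddCommGroup V] [Module ℚ V]
    (L : AddSubgroup V) {x : V} (hx : x ∈ Submodule.span ℚ (L : Set V)) :
    ∃ m : ℕ, m ≠ 0 ∧ m • x ∈ L := by
  induction hx using Submodule.span_induction with
  | mem x h => exact ⟨1, one_ne_zero, by simpa using h⟩
  | zero => exact ⟨1, one_ne_zero, by simp⟩
  | add x y _ _ hx hy =>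
    obtain ⟨m, hm, hmx⟩ := hx
    obtain ⟨n, hn, hny⟩ := hy
    refine ⟨m * n, mul_ne_zero hm hn, ?_⟩
    rw [smul_add]
    refine add_mem ?_ ?_
    · rw [mul_comm, mul_smul]; exact L.nsmul_mem hmx n
    · rw [mul_smul]; exact L.nsmul_mem hny m
  | smul q x _ hx =>
    obtain ⟨m, hm, hmx⟩ := hx
    refine ⟨m * q.den, mul_ne_zero hm q.den_ne_zero, ?_⟩
    have : (m * q.den) • q • x = q.num • m • x := by
      rw [← Nat.cast_smul_eq_nsmul ℚ, ← Nat.cast_smul_eq_nsmul ℚ m, ← Int.cast_smul_eq_zsmul ℚ,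
        smul_smul, smul_smul]
      congr 1
      push_cast
      rw [mul_assoc, mul_comm (q.den : ℚ) q, Rat.mul_den_eq_num, mul_comm]
    rw [this]
    exact L.zsmul_mem hmx _

/-- Compose `τ` with a linear projection to the rational span of `τ(A)`: the kernel is `K`, and the
preimage of `τ(A)` is `H`. Every element of the rational span has a multiple in `τ(A)`, so the image
of `G` modulo `τ(A)` is finitely generated and torsion, hence finite. A real projection would not
do, since `τ(G)` may be dense in the real span. -/
theorem exists_complement_finiteIndex {G : Type*} [Group G] [Group.FG G] {V : Type*}
    [AddCommGroup V] [Module ℚ V] (τ : G →* Multiplicative V) (A : Subgroup G)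
    (hinj : ∀ a ∈ A, τ a = 1 → a = 1) :
    ∃ K H : Subgroup G, H.FiniteIndex ∧ A ≤ H ∧ K ⊓ A = ⊥ ∧ ∀ h ∈ H, ∃ a ∈ A, h * a⁻¹ ∈ K := by
  set L : AddSubgroup V := (A.map τ).toAddSubgroup' with hL
  obtain ⟨P, hP⟩ := (Submodule.span ℚ (L : Set V)).subtype.exists_leftInverse_of_injective
    (Submodule.ker_subtype _)
  have hPL : ∀ a ∈ A, (P (τ a).toAdd : V) = (τ a).toAdd := by
    intro a ha
    have hmem : (τ a).toAdd ∈ L := ⟨a, ha, rfl⟩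
    have := LinearMap.congr_fun hP ⟨_, Submodule.subset_span hmem⟩
    exact congrArg Subtype.val this
  set π : G →* Multiplicative V :=
    (AddMonoidHom.toMultiplicative
      ((Submodule.subtype _).comp P).toAddMonoidHom).comp τ with hπ
  have hπA : ∀ a ∈ A, π a = τ a := fun a ha => hPL a ha
  set LM : Subgroup (Multiplicative V) := A.map τ with hLM
  set ψ : G →* Multiplicative V ⧸ LM := (QuotientGroup.mk' LM).comp π with hψ
  refine ⟨π.ker, ψ.ker, ?_, ?_, ?_, ?_⟩
  · have : Finite ψ.range := by
      apply CommGroup.finite_of_fg_isMulTorsion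
      rintro ⟨_, g, rfl⟩
      rw [← Submonoid.isOfFinOrder_coe, isOfFinOrder_iff_pow_eq_one]
      obtain ⟨m, hm, hmx⟩ := exists_nsmul_mem_of_mem_span L (P (τ g).toAdd).2
      refine ⟨m, Nat.pos_of_ne_zero hm, ?_⟩
      exact (QuotientGroup.eq_one_iff (N := LM) (π g ^ m)).2 hmx
    exact finiteIndex_ker ψ
  · intro a ha
    rw [MonoidHom.mem_ker]
    exact (QuotientGroup.eq_one_iff (N := LM) (π a)).2 (by rw [hπA a ha]; exact ⟨a, ha, rfl⟩)
  · rw [eq_bot_iff]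
    rintro a ⟨ha, haA⟩
    exact mem_bot.2 (hinj a haA (by rw [← hπA a haA]; exact ha))
  · intro h hh
    obtain ⟨a, ha, hah⟩ := (QuotientGroup.eq_one_iff (N := LM) (π h)).1 hh
    refine ⟨a, ha, ?_⟩
    rw [MonoidHom.mem_ker, map_mul, map_inv, hπA a ha, hah, mul_inv_cancel]

theorem exists_virtual_splitting {G : Type*} [Group G] (N A : Subgroup G)
    [N.FiniteIndex] [A.Normal] (hN : Group.FG N) (hAN : A ≤ N)
    (hcomm : ∀ a ∈ A, ∀ n ∈ N, a * n = n * a) {V : Type*} [AddCommGroup V] [Module ℚ V]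
    (τ : N →* Multiplicative V) (hinj : ∀ a : N, (a : G) ∈ A → τ a = 1 → a = 1) :
    ∃ K H : Subgroup G, H.Normal ∧ H.FiniteIndex ∧ H ≤ N ∧ K ≤ H ∧
      IsInternalDirectProduct H K A := by
  obtain ⟨K₀, H₀, hH₀, hAH, hKA, hdec⟩ := exists_complement_finiteIndex τ (A.subgroupOf N)
    (fun a ha => hinj a ha)
  set H₁ := H₀.map N.subtype with hH₁
  have hH₁N : H₁ ≤ N := map_subtype_le H₀
  have hAH₁ : A ≤ H₁ := fun a ha => ⟨⟨a, hAN ha⟩, hAH ha, rfl⟩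
  have hfin : H₁.FiniteIndex := by
    rw [finiteIndex_iff, index_map_subtype]
    exact mul_ne_zero hH₀.index_ne_zero FiniteIndex.index_ne_zero
  -- The normal core need not contain `A`; adjoining the normal subgroup `A` keeps the group normal
  -- and inside `H₁`.
  set H := H₁.normalCore ⊔ A with hH
  have hHH₁ : H ≤ H₁ := sup_le (normalCore_le _) hAH₁
  refine ⟨K₀.map N.subtype ⊓ H, H, inferInstance, finiteIndex_of_le le_sup_left,
    hHH₁.trans hH₁N, inf_le_right, ?_, ?_, ?_⟩
  · rintro k ⟨-, hk⟩ a ha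
    exact (hcomm a ha k (hH₁N (hHH₁ hk))).symm
  · rw [eq_bot_iff]
    rintro x ⟨⟨⟨y, hy, rfl⟩, -⟩, hxA⟩
    have : y ∈ K₀ ⊓ A.subgroupOf N := ⟨hy, hxA⟩
    rw [hKA, mem_bot] at this
    rw [this]
    exact one_mem _
  · refine le_antisymm (sup_le inf_le_right le_sup_right) fun h hh => ?_
    obtain ⟨y, hy, rfl⟩ := hHH₁ hh
    obtain ⟨a, ha, hak⟩ := hdec y hy
    have hsplit : N.subtype y = N.subtype (y * a⁻¹) * (a : G) := by simp
    rw [hsplit]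
    refine mul_mem_sup (mem_inf.2 ⟨mem_map_of_mem _ hak, ?_⟩) ha
    have : N.subtype (y * a⁻¹) = N.subtype y * (a : G)⁻¹ := by simp
    rw [this]
    exact mul_mem hh (inv_mem (le_sup_right (a := H₁.normalCore) ha))

end Nilpotent

open Set Filter Topology

/-! ### Spaces satisfying the inequality of Bruhat and Tits -/

section CN

/-- Any two points are joined by a geodesic satisfying the inequality of Bruhat and Tits. -/
class CNSpace (X : Type*) [MetricSpace X] : Prop where
  exists_point : ∀ (x y : X) (t : ℝ), 0 ≤ t ∧ t ≤ 1 → ∃ p : X, ∀ z : X,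
    dist z p ^ 2 ≤ (1 - t) * dist z x ^ 2 + t * dist z y ^ 2 - t * (1 - t) * dist x y ^ 2

variable {X : Type*} [MetricSpace X] [CNSpace X]

/-- The point dividing the geodesic from `x` to `y` in the ratio `t : 1 - t`. -/
def geodesicPoint (x y : X) (t : ℝ) : X :=
  if h : 0 ≤ t ∧ t ≤ 1 then (CNSpace.exists_point x y t h).choose else x

theorem dist_geodesicPoint_sq_le (x y z : X) {t : ℝ} (h0 : 0 ≤ t) (h1 : t ≤ 1) :
    dist z (geodesicPoint x y t) ^ 2 ≤
      (1 - t) * dist z x ^ 2 + t * dist z y ^ 2 - t * (1 - t) * dist x y ^ 2 := by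
  have h : 0 ≤ t ∧ t ≤ 1 := ⟨h0, h1⟩
  rw [geodesicPoint, dif_pos h]
  exact (CNSpace.exists_point x y t h).choose_spec z

theorem dist_left_geodesicPoint_le (x y : X) {t : ℝ} (h0 : 0 ≤ t) (h1 : t ≤ 1) :
    dist x (geodesicPoint x y t) ≤ t * dist x y := by
  have h := dist_geodesicPoint_sq_le x y x h0 h1
  rw [dist_self] at h
  refine abs_le_of_sq_le_sq' ?_ (by positivity) |>.2
  nlinarith

theorem dist_geodesicPoint_right_le (x y : X) {t : ℝ} (h0 : 0 ≤ t) (h1 : t ≤ 1) :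
    dist (geodesicPoint x y t) y ≤ (1 - t) * dist x y := by
  have h := dist_geodesicPoint_sq_le x y y h0 h1
  rw [dist_self, dist_comm y x] at h
  rw [dist_comm]
  refine abs_le_of_sq_le_sq' ?_ (mul_nonneg (by linarith) dist_nonneg) |>.2
  nlinarith

theorem dist_left_geodesicPoint (x y : X) {t : ℝ} (h0 : 0 ≤ t) (h1 : t ≤ 1) :
    dist x (geodesicPoint x y t) = t * dist x y := by
  have h2 := dist_left_geodesicPoint_le x y h0 h1
  have h3 := dist_geodesicPoint_right_le x y h0 h1
  have h4 := dist_triangle x (geodesicPoint x y t) y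
  linarith

theorem dist_geodesicPoint_right (x y : X) {t : ℝ} (h0 : 0 ≤ t) (h1 : t ≤ 1) :
    dist (geodesicPoint x y t) y = (1 - t) * dist x y := by
  have h2 := dist_left_geodesicPoint_le x y h0 h1
  have h3 := dist_geodesicPoint_right_le x y h0 h1
  have h4 := dist_triangle x (geodesicPoint x y t) y
  linarith

/-- Uniqueness of geodesics: with `z = p` the right-hand side of the Bruhat–Tits inequality is at
most `0`. -/
theorem eq_geodesicPoint {x y p : X} {t : ℝ} (h0 : 0 ≤ t) (h1 : t ≤ 1)
    (hx : dist x p ≤ t * dist x y) (hy : dist p y ≤ (1 - t) * dist x y) :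
    p = geodesicPoint x y t := by
  have h := dist_geodesicPoint_sq_le x y p h0 h1
  have hx2 : dist p x ^ 2 ≤ (t * dist x y) ^ 2 := by
    rw [dist_comm]; exact pow_le_pow_left₀ dist_nonneg hx 2
  have hy2 : dist p y ^ 2 ≤ ((1 - t) * dist x y) ^ 2 := pow_le_pow_left₀ dist_nonneg hy 2
  have h5 := mul_le_mul_of_nonneg_left hx2 (sub_nonneg.2 h1)
  have h6 := mul_le_mul_of_nonneg_left hy2 h0
  have h7 : dist p (geodesicPoint x y t) ^ 2 ≤ 0 := by nlinarith
  have h8 : dist p (geodesicPoint x y t) = 0 := by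
    have := sq_nonneg (dist p (geodesicPoint x y t))
    exact pow_eq_zero_iff two_ne_zero |>.1 (le_antisymm h7 this)
  exact dist_eq_zero.1 h8

theorem geodesicPoint_symm (x y : X) {t : ℝ} (h0 : 0 ≤ t) (h1 : t ≤ 1) :
    geodesicPoint y x (1 - t) = geodesicPoint x y t := by
  apply eq_geodesicPoint h0 h1
  · rw [dist_comm, dist_geodesicPoint_right y x (by linarith) (by linarith), dist_comm y x]
    simp
  · rw [dist_comm, dist_left_geodesicPoint y x (by linarith) (by linarith), dist_comm y x]

theorem map_geodesicPoint (g : X ≃ᵢ X) (x y : X) {t : ℝ} (h0 : 0 ≤ t) (h1 : t ≤ 1) :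
    g (geodesicPoint x y t) = geodesicPoint (g x) (g y) t := by
  apply eq_geodesicPoint h0 h1
  · rw [g.dist_eq, g.dist_eq, dist_left_geodesicPoint x y h0 h1]
  · rw [g.dist_eq, g.dist_eq, dist_geodesicPoint_right x y h0 h1]

/-- The squares of the diagonals of a quadrilateral are bounded by the squares of its sides. -/
theorem dist_sq_add_dist_sq_le (a b c d : X) :
    dist a c ^ 2 + dist b d ^ 2 ≤
      dist a b ^ 2 + dist b c ^ 2 + dist c d ^ 2 + dist d a ^ 2 := by
  set m := geodesicPoint a c (1 / 2)
  have h1 := dist_geodesicPoint_sq_le a c b (t := 1 / 2) (by norm_num) (by norm_num)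
  have h2 := dist_geodesicPoint_sq_le a c d (t := 1 / 2) (by norm_num) (by norm_num)
  have h3 : dist b d ≤ dist b m + dist d m := dist_triangle_right b d m
  have h4 : dist b d ^ 2 ≤ (dist b m + dist d m) ^ 2 := pow_le_pow_left₀ dist_nonneg h3 2
  rw [dist_comm b a] at h1
  rw [dist_comm d c] at h2
  nlinarith [sq_nonneg (dist b m - dist d m)]

theorem dist_geodesicPoint_geodesicPoint_le_of_left (x y z : X) {t : ℝ} (h0 : 0 ≤ t)
    (h1 : t ≤ 1) : dist (geodesicPoint x y t) (geodesicPoint x z t) ≤ t * dist y z := by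
  set p := geodesicPoint x y t
  have h2 := dist_geodesicPoint_sq_le x z p h0 h1
  have h3 := dist_geodesicPoint_sq_le x y z h0 h1
  have h4 : dist p x = t * dist x y := by rw [dist_comm, dist_left_geodesicPoint x y h0 h1]
  rw [h4, dist_comm p z] at h2
  have h5 := mul_le_mul_of_nonneg_left h3 h0
  rw [dist_comm z x, dist_comm z y] at h5
  refine abs_le_of_sq_le_sq' ?_ (by positivity) |>.2
  nlinarith

theorem dist_geodesicPoint_geodesicPoint_le (x y x' y' : X) {t : ℝ} (h0 : 0 ≤ t) (h1 : t ≤ 1) :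
    dist (geodesicPoint x y t) (geodesicPoint x' y' t) ≤
      (1 - t) * dist x x' + t * dist y y' := by
  have h2 := dist_geodesicPoint_geodesicPoint_le_of_left x y y' h0 h1
  have h3 := dist_geodesicPoint_geodesicPoint_le_of_left y' x x' (t := 1 - t) (by linarith)
    (by linarith)
  rw [geodesicPoint_symm x y' h0 h1, geodesicPoint_symm x' y' h0 h1] at h3
  have := dist_triangle (geodesicPoint x y t) (geodesicPoint x y' t) (geodesicPoint x' y' t)
  linarith

/-! ### Convex subsets and projections -/

/-- The set contains the geodesics between its points. -/
def IsCNConvex (C : Set X) : Prop :=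
  ∀ x ∈ C, ∀ y ∈ C, ∀ t : ℝ, 0 ≤ t → t ≤ 1 → geodesicPoint x y t ∈ C

theorem IsCNConvex.cnSpace {C : Set X} (hC : IsCNConvex C) : CNSpace C :=
  ⟨fun x y t ht => ⟨⟨geodesicPoint x.1 y.1 t, hC _ x.2 _ y.2 t ht.1 ht.2⟩,
    fun z => dist_geodesicPoint_sq_le x.1 y.1 z.1 ht.1 ht.2⟩⟩

theorem IsCNConvex.isGeodesicallyConvex {C : Set X} (hC : IsCNConvex C) :
    IsGeodesicallyConvex C := by
  intro c l hc h0 hl t ht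
  have hl0 := hc.1
  have hm0 : (0 : ℝ) ∈ Icc 0 l := ⟨le_rfl, hl0⟩
  have hml : l ∈ Icc 0 l := ⟨hl0, le_rfl⟩
  rcases hl0.eq_or_lt with h | h
  · have : t = 0 := le_antisymm (h ▸ ht.2) ht.1
    rw [this]; exact h0
  have hd : dist (c 0) (c l) = l := by
    rw [hc.2 _ hm0 _ hml, zero_sub, abs_neg, abs_of_pos h]
  have ht1 : t / l ≤ 1 := (div_le_one h).2 ht.2
  have ht0 : 0 ≤ t / l := div_nonneg ht.1 hl0
  have : c t = geodesicPoint (c 0) (c l) (t / l) := by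
    apply eq_geodesicPoint ht0 ht1
    · rw [hc.2 _ hm0 _ ht, hd, zero_sub, abs_neg, abs_of_nonneg ht.1, div_mul_cancel₀ _ h.ne']
    · rw [hc.2 _ ht _ hml, hd, abs_sub_comm, abs_of_nonneg (sub_nonneg.2 ht.2), sub_mul,
        div_mul_cancel₀ _ h.ne', one_mul]
  rw [this]
  exact hC _ h0 _ hl _ ht0 ht1

theorem IsCNConvex.inter {C D : Set X} (hC : IsCNConvex C) (hD : IsCNConvex D) :
    IsCNConvex (C ∩ D) :=
  fun x hx y hy t h0 h1 => ⟨hC x hx.1 y hy.1 t h0 h1, hD x hx.2 y hy.2 t h0 h1⟩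

/-- Minimizing sequences are Cauchy by the Bruhat–Tits inequality at midpoints. The stated
inequality says that the angle at the projection is at least a right angle; it follows by comparing
`p` with the points of the geodesic to `c` near `p`. -/
theorem IsCNConvex.exists_projection [CompleteSpace X] {C : Set X} (hC : IsCNConvex C)
    (hcl : IsClosed C) (hne : C.Nonempty) (x : X) :
    ∃ p ∈ C, ∀ c ∈ C, dist x p ^ 2 + dist p c ^ 2 ≤ dist x c ^ 2 := by
  set δ := sInf ((fun c => dist x c ^ 2) '' C) with hδ
  have hbdd : BddBelow ((fun c => dist x c ^ 2) '' C) :=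
    ⟨0, by rintro _ ⟨c, -, rfl⟩; exact sq_nonneg _⟩
  have hδle : ∀ c ∈ C, δ ≤ dist x c ^ 2 := fun c hc => csInf_le hbdd ⟨c, hc, rfl⟩
  have hseq : ∀ n : ℕ, ∃ c ∈ C, dist x c ^ 2 < δ + 1 / (n + 1) := by
    intro n
    obtain ⟨_, ⟨c, hc, rfl⟩, h⟩ := exists_lt_of_csInf_lt (hne.image _)
      (show δ < δ + 1 / ((n : ℝ) + 1) by have : (0:ℝ) < 1 / (n + 1) := by positivity
                                         linarith)
    exact ⟨c, hc, h⟩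
  choose c hcC hc using hseq
  have hdist : ∀ a ∈ C, ∀ b ∈ C, dist a b ^ 2 ≤ 2 * (dist x a ^ 2 - δ) + 2 * (dist x b ^ 2 - δ) := by
    intro a ha b hb
    have h := dist_geodesicPoint_sq_le a b x (t := 1 / 2) (by norm_num) (by norm_num)
    have := hδle _ (hC a ha b hb (1 / 2) (by norm_num) (by norm_num))
    linarith
  have hcau : CauchySeq c := by
    rw [Metric.cauchySeq_iff']
    intro ε hε
    obtain ⟨n, hn⟩ := exists_nat_gt (4 / ε ^ 2)
    refine ⟨n, fun m hm => ?_⟩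
    have hd := hdist _ (hcC m) _ (hcC n)
    have hn0 : (0 : ℝ) < n + 1 := by positivity
    have h1 : (1 : ℝ) / (m + 1) ≤ 1 / (n + 1) := by
      apply one_div_le_one_div_of_le hn0
      have : (n : ℝ) ≤ m := by exact_mod_cast hm
      linarith
    have h2 : 4 * (1 / ((n : ℝ) + 1)) < ε ^ 2 := by
      rw [div_lt_iff₀ (by positivity)] at hn
      rw [mul_one_div, div_lt_iff₀ hn0]
      nlinarith [sq_pos_of_pos hε]
    have h3 : dist (c m) (c n) ^ 2 < ε ^ 2 := by linarith [hc m, hc n]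
    exact lt_of_pow_lt_pow_left₀ 2 hε.le h3
  obtain ⟨p, hp⟩ := cauchySeq_tendsto_of_complete hcau
  have hpC : p ∈ C := hcl.mem_of_tendsto hp (Eventually.of_forall hcC)
  have hpδ : dist x p ^ 2 ≤ δ := by
    have h1 : Tendsto (fun n => dist x (c n) ^ 2) atTop (𝓝 (dist x p ^ 2)) :=
      (tendsto_const_nhds.dist hp).pow 2
    have h2 : Tendsto (fun n : ℕ => δ + 1 / ((n : ℝ) + 1)) atTop (𝓝 (δ + 0)) :=
      tendsto_const_nhds.add tendsto_one_div_add_atTop_nhds_zero_nat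
    rw [add_zero] at h2
    exact le_of_tendsto_of_tendsto' h1 h2 fun n => (hc n).le
  refine ⟨p, hpC, fun q hq => ?_⟩
  have key : ∀ t : ℝ, 0 < t → t ≤ 1 →
      dist x p ^ 2 + (1 - t) * dist p q ^ 2 ≤ dist x q ^ 2 := by
    intro t h0 h1
    have h := dist_geodesicPoint_sq_le p q x h0.le h1
    have h2 := hδle _ (hC p hpC q hq t h0.le h1)
    have h3 : t * (dist x p ^ 2 + (1 - t) * dist p q ^ 2) ≤ t * dist x q ^ 2 := by nlinarith
    exact le_of_mul_le_mul_left h3 h0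
  have hlim : Tendsto (fun n : ℕ => dist x p ^ 2 + (1 - 1 / ((n : ℝ) + 1)) * dist p q ^ 2) atTop
      (𝓝 (dist x p ^ 2 + (1 - 0) * dist p q ^ 2)) :=
    tendsto_const_nhds.add
      ((tendsto_const_nhds.sub tendsto_one_div_add_atTop_nhds_zero_nat).mul tendsto_const_nhds)
  rw [sub_zero, one_mul] at hlim
  refine le_of_tendsto' hlim fun n => key _ (by positivity) ?_
  rw [div_le_one (by positivity)]
  linarith [(Nat.cast_nonneg n : (0 : ℝ) ≤ n)]

/-- The projection to an invariant closed convex subset does not increase the displacement. -/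
theorem IsCNConvex.exists_dist_le [CompleteSpace X] {C : Set X} (hC : IsCNConvex C)
    (hcl : IsClosed C) (hne : C.Nonempty) (g : X ≃ᵢ X) (hg : ∀ x, g x ∈ C ↔ x ∈ C) (x : X) :
    ∃ p ∈ C, dist p (g p) ≤ dist x (g x) := by
  obtain ⟨p, hpC, hp⟩ := hC.exists_projection hcl hne x
  refine ⟨p, hpC, ?_⟩
  have h1 := hp (g p) ((hg p).2 hpC)
  have h2 : dist (g x) (g p) ^ 2 + dist (g p) p ^ 2 ≤ dist (g x) p ^ 2 := by
    have := hp (g.symm p) (by rw [← hg, g.apply_symm_apply]; exact hpC)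
    rwa [← g.dist_eq x (g.symm p), ← g.dist_eq p (g.symm p), g.apply_symm_apply,
      ← g.dist_eq x p] at this
  -- The two obtuse angles at `p` and `g p` bound the diagonals of this quadrilateral from below,
  -- while its sides bound them from above.
  have h3 := dist_sq_add_dist_sq_le x (g x) (g p) p
  rw [dist_comm (g p) p] at h2 h3
  rw [g.dist_eq] at h2 h3
  rw [dist_comm p x] at h3
  refine abs_le_of_sq_le_sq' ?_ dist_nonneg |>.2
  linarith

/-! ### Isometries -/

/-- The set of points minimizing the displacement. -/
def minSet {X : Type*} [MetricSpace X] (g : X ≃ᵢ X) : Set X :=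
  {x | ∀ y, dist x (g x) ≤ dist y (g y)}

theorem translationLength_of_mem_minSet {X : Type u} [MetricSpace X] {g : X ≃ᵢ X} {x : X}
    (hx : x ∈ minSet g) : translationLength g = dist x (g x) := by
  have : Nonempty X := ⟨x⟩
  exact le_antisymm (ciInf_le ⟨0, by rintro _ ⟨y, rfl⟩; exact dist_nonneg⟩ x) (le_ciInf hx)

theorem isSemisimple_iff {X : Type u} [MetricSpace X] {g : X ≃ᵢ X} :
    IsSemisimple g ↔ (minSet g).Nonempty := by
  constructor
  · rintro ⟨x, hx⟩
    refine ⟨x, fun y => ?_⟩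
    rw [hx]
    exact ciInf_le ⟨0, by rintro _ ⟨y, rfl⟩; exact dist_nonneg⟩ y
  · rintro ⟨x, hx⟩
    exact ⟨x, (translationLength_of_mem_minSet hx).symm⟩

theorem isClosed_minSet {X : Type*} [MetricSpace X] (g : X ≃ᵢ X) : IsClosed (minSet g) := by
  have : minSet g = ⋂ y, {x | dist x (g x) ≤ dist y (g y)} := by
    ext x; simp [minSet]
  rw [this]
  exact isClosed_iInter fun y =>
    isClosed_le (continuous_id.dist g.continuous) continuous_const

theorem isCNConvex_minSet (g : X ≃ᵢ X) : IsCNConvex (minSet g) := by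
  intro x hx y hy t h0 h1 z
  rw [map_geodesicPoint g x y h0 h1]
  refine (dist_geodesicPoint_geodesicPoint_le x y (g x) (g y) h0 h1).trans ?_
  have h2 := mul_le_mul_of_nonneg_left (hx z) (sub_nonneg.2 h1)
  have h3 := mul_le_mul_of_nonneg_left (hy z) h0
  linarith

theorem apply_mem_minSet_conj_iff {X : Type*} [MetricSpace X] (g h : X ≃ᵢ X) (x : X) :
    h x ∈ minSet (h * g * h⁻¹) ↔ x ∈ minSet g := by
  have e : ∀ y, dist (h y) ((h * g * h⁻¹) (h y)) = dist y (g y) := by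
    intro y
    have : (h * g * h⁻¹) (h y) = h (g y) := by
      simp [IsometryEquiv.mul_apply]
    rw [this, h.dist_eq]
  constructor
  · intro hx y
    rw [← e x, ← e y]; exact hx _
  · intro hx y
    obtain ⟨z, rfl⟩ := h.surjective y
    rw [e, e]; exact hx z

theorem apply_mem_minSet_iff_of_commute {X : Type*} [MetricSpace X] {g h : X ≃ᵢ X}
    (hc : Commute g h) (x : X) : h x ∈ minSet g ↔ x ∈ minSet g := by
  have := apply_mem_minSet_conj_iff g h x
  rwa [← hc.eq, mul_inv_cancel_right] at this

theorem minSet_inv {X : Type*} [MetricSpace X] (g : X ≃ᵢ X) : minSet g⁻¹ = minSet g := by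
  have e : ∀ y, dist y (g⁻¹ y) = dist y (g y) := by
    intro y
    rw [← g.dist_eq, IsometryEquiv.apply_inv_self, dist_comm]
  ext x
  simp only [minSet, mem_ofPred_eq, e]

/-- A point of an invariant closed convex subset minimizes the displacement if it does so among the
points of the subset. -/
theorem IsCNConvex.mem_minSet [CompleteSpace X] {C : Set X} (hC : IsCNConvex C)
    (hcl : IsClosed C) (g : X ≃ᵢ X) (hg : ∀ x, g x ∈ C ↔ x ∈ C) {x : X} (hx : x ∈ C)
    (hmin : ∀ y ∈ C, dist x (g x) ≤ dist y (g y)) : x ∈ minSet g := by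
  intro y
  obtain ⟨p, hp, hle⟩ := hC.exists_dist_le hcl ⟨x, hx⟩ g hg y
  exact (hmin p hp).trans hle

theorem IsCNConvex.inter_minSet_nonempty [CompleteSpace X] {C : Set X} (hC : IsCNConvex C)
    (hcl : IsClosed C) (hne : C.Nonempty) (g : X ≃ᵢ X) (hg : ∀ x, g x ∈ C ↔ x ∈ C)
    (hgs : (minSet g).Nonempty) : (C ∩ minSet g).Nonempty := by
  obtain ⟨y, hy⟩ := hgs
  obtain ⟨p, hp, hle⟩ := hC.exists_dist_le hcl hne g hg y
  exact ⟨p, hp, fun z => hle.trans (hy z)⟩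

/-- The restriction of an isometry to an invariant subset. -/
def restrictIsometry {X : Type*} [MetricSpace X] (g : X ≃ᵢ X) (C : Set X)
    (hg : ∀ x, g x ∈ C ↔ x ∈ C) : C ≃ᵢ C where
  toFun x := ⟨g x, (hg x).2 x.2⟩
  invFun x := ⟨g.symm x, by rw [← hg, g.apply_symm_apply]; exact x.2⟩
  left_inv x := Subtype.ext (g.symm_apply_apply x)
  right_inv x := Subtype.ext (g.apply_symm_apply x)
  isometry_toFun := fun x y => g.isometry x y

@[simp]
theorem restrictIsometry_apply {X : Type*} [MetricSpace X] (g : X ≃ᵢ X) (C : Set X)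
    (hg : ∀ x, g x ∈ C ↔ x ∈ C) (x : C) : (restrictIsometry g C hg x : X) = g x := rfl

/-- All points have the same displacement. -/
def HasConstDisplacement {X : Type*} [MetricSpace X] (g : X ≃ᵢ X) (l : ℝ) : Prop :=
  ∀ x, dist x (g x) = l

/-- The midpoints of `[x, g x]` and `[g x, g² x]` are also at distance `l`, since `g` maps the first
to the second. Midpoint comparison in the triangle `x, g x, g² x` then forces its third side to be
at least `2 * l`. -/
theorem HasConstDisplacement.mul_self {g : X ≃ᵢ X} {l : ℝ} (hg : HasConstDisplacement g l) :
    HasConstDisplacement (g * g) (2 * l) := by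
  intro x
  set m := geodesicPoint x (g x) (1 / 2)
  have h1 : g m = geodesicPoint (g x) (g (g x)) (1 / 2) :=
    map_geodesicPoint g _ _ (by norm_num) (by norm_num)
  have h2 : m = geodesicPoint (g x) x (1 / 2) := by
    have := geodesicPoint_symm (g x) x (t := 1 / 2) (by norm_num) (by norm_num)
    rw [← this]; norm_num [m]
  have h3 := dist_geodesicPoint_geodesicPoint_le_of_left (g x) x (g (g x)) (t := 1 / 2)
    (by norm_num) (by norm_num)
  rw [← h1, ← h2, hg m] at h3
  have h4 := dist_triangle x (g x) (g (g x))
  rw [hg x, hg (g x)] at h4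
  rw [IsometryEquiv.mul_apply]
  linarith

theorem dist_pow_le {X : Type*} [MetricSpace X] (g : X ≃ᵢ X) (x : X) (n : ℕ) :
    dist x ((g ^ n) x) ≤ n * dist x (g x) := by
  induction n with
  | zero => simp
  | succ n ih =>
    have h1 := dist_triangle x ((g ^ n) x) ((g ^ (n + 1)) x)
    rw [pow_succ, IsometryEquiv.mul_apply, (g ^ n).dist_eq] at h1
    rw [pow_succ, IsometryEquiv.mul_apply]
    push_cast
    linarith

theorem HasConstDisplacement.pow_two_pow {g : X ≃ᵢ X} {l : ℝ} (hg : HasConstDisplacement g l)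
    (n : ℕ) : HasConstDisplacement (g ^ 2 ^ n) (2 ^ n * l) := by
  induction n with
  | zero => simpa using hg
  | succ n ih =>
    have := ih.mul_self
    rw [← pow_two, ← pow_mul, ← pow_succ] at this
    convert this using 1
    ring

/-- For the larger exponent `2 ^ n` the displacement is exactly `2 ^ n * l`, which leaves no slack
in the triangle inequality at the intermediate exponent `n`. -/
theorem HasConstDisplacement.pow {g : X ≃ᵢ X} {l : ℝ} (hg : HasConstDisplacement g l)
    (n : ℕ) : HasConstDisplacement (g ^ n) (n * l) := by
  intro x
  have hn : n < 2 ^ n := Nat.lt_two_pow_self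
  have h1 := dist_pow_le g x n
  have h2 := dist_pow_le g ((g ^ n) x) (2 ^ n - n)
  have h3 := hg.pow_two_pow n x
  have h4 := dist_triangle x ((g ^ n) x) ((g ^ 2 ^ n) x)
  have h5 : (g ^ 2 ^ n) x = (g ^ (2 ^ n - n)) ((g ^ n) x) := by
    rw [← IsometryEquiv.mul_apply, ← pow_add, Nat.sub_add_cancel hn.le]
  rw [← h5, hg, Nat.cast_sub hn.le] at h2
  rw [hg] at h1
  push_cast at h2
  linarith

theorem eq_of_forall_two_pow_mul_le {a b c : ℝ} (h : ∀ n : ℕ, |2 ^ n * a - 2 ^ n * b| ≤ c) :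
    a = b := by
  by_contra hab
  have hpos : 0 < |a - b| := abs_pos.2 (sub_ne_zero.2 hab)
  obtain ⟨n, hn⟩ := pow_unbounded_of_one_lt (c / |a - b|) (one_lt_two)
  have := h n
  rw [← mul_sub, abs_mul, abs_of_pos (by positivity : (0 : ℝ) < 2 ^ n)] at this
  rw [div_lt_iff₀ hpos] at hn
  linarith

theorem abs_dist_apply_sub_dist_apply_le {X : Type*} [MetricSpace X] (g : X ≃ᵢ X) (x y : X) :
    |dist x (g x) - dist y (g y)| ≤ 2 * dist x y := by
  have h1 := dist_triangle4 x y (g y) (g x)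
  have h2 := dist_triangle4 y x (g x) (g y)
  rw [g.dist_eq] at h1 h2
  rw [dist_comm y x] at h1 h2
  rw [abs_le]
  constructor <;> linarith

/-- In the triangle `x, g² x, h⁻² x` the points `g x` and `h⁻¹ x` are midpoints of two sides. By
commutation, their distance is the displacement of `g * h` at `x`, and the third side is that of its
square. -/
theorem HasConstDisplacement.dist_mul_mul {g h : X ≃ᵢ X} {a b : ℝ}
    (hg : HasConstDisplacement g a) (hh : HasConstDisplacement h b) (hc : Commute g h) (x : X) :
    dist x ((g * h * (g * h)) x) = 2 * dist x ((g * h) x) := by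
  have hm : ∀ (f : X ≃ᵢ X) (l : ℝ), HasConstDisplacement f l →
      f x = geodesicPoint x (f (f x)) (1 / 2) := by
    intro f l hf
    have h2 := hf.mul_self x
    rw [IsometryEquiv.mul_apply] at h2
    apply eq_geodesicPoint (by norm_num) (by norm_num)
    · rw [h2, hf]; linarith
    · rw [h2, hf]; linarith
  have hinv : HasConstDisplacement h⁻¹ b := by
    intro y
    rw [← h.dist_eq, IsometryEquiv.apply_inv_self, dist_comm, hh]
  have h1 := dist_geodesicPoint_geodesicPoint_le_of_left x (g (g x)) (h⁻¹ (h⁻¹ x)) (t := 1 / 2)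
    (by norm_num) (by norm_num)
  rw [← hm g a hg, ← hm h⁻¹ b hinv] at h1
  have e1 : dist (g x) (h⁻¹ x) = dist x ((g * h) x) := by
    rw [← h.dist_eq, IsometryEquiv.apply_inv_self, dist_comm, hc.eq, IsometryEquiv.mul_apply]
  have e2 : dist (g (g x)) (h⁻¹ (h⁻¹ x)) = dist x ((g * h * (g * h)) x) := by
    have : g * h * (g * h) = h * (h * (g * g)) := by
      calc g * h * (g * h) = g * (h * g) * h := by group
        _ = (g * g) * (h * h) := by rw [← hc.eq]; group
        _ = (h * h) * (g * g) := by
          exact ((hc.mul_right hc).mul_left (hc.mul_right hc)).eq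
        _ = h * (h * (g * g)) := by group
    rw [this, ← h.dist_eq, IsometryEquiv.apply_inv_self, ← h.dist_eq,
      IsometryEquiv.apply_inv_self, dist_comm]
    rfl
  rw [e1, e2] at h1
  have h3 := dist_triangle x ((g * h) x) ((g * h * (g * h)) x)
  rw [IsometryEquiv.mul_apply (g * h) (g * h), (g * h).dist_eq] at h3
  rw [IsometryEquiv.mul_apply (g * h) (g * h)] at h1 ⊢
  linarith

/-- The displacement of `(g * h) ^ 2 ^ n` is `2 ^ n` times that of `g * h`, yet between two fixed
points it varies by a bounded amount only. -/
theorem HasConstDisplacement.mul [Nonempty X] {g h : X ≃ᵢ X} {a b : ℝ}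
    (hg : HasConstDisplacement g a) (hh : HasConstDisplacement h b) (hc : Commute g h) :
    ∃ l, HasConstDisplacement (g * h) l := by
  have key : ∀ (n : ℕ) (x : X), dist x (((g * h) ^ 2 ^ n) x) = 2 ^ n * dist x ((g * h) x) := by
    intro n
    induction n with
    | zero => simp
    | succ n ih =>
      intro x
      have h1 := (hg.pow (2 ^ n)).dist_mul_mul (hh.pow (2 ^ n)) (hc.pow_pow _ _) x
      rw [← hc.mul_pow, ih x] at h1
      rw [pow_succ 2 n, mul_two, pow_add, h1]
      ring
  obtain ⟨x₀⟩ := ‹Nonempty X›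
  refine ⟨dist x₀ ((g * h) x₀), fun x => ?_⟩
  apply eq_of_forall_two_pow_mul_le (c := 2 * dist x x₀)
  intro n
  rw [← key, ← key]
  exact abs_dist_apply_sub_dist_apply_le _ _ _

theorem hasConstDisplacement_restrict_of_subset {X : Type*} [MetricSpace X] (g : X ≃ᵢ X)
    (C : Set X) (hg : ∀ x, g x ∈ C ↔ x ∈ C) (hC : C ⊆ minSet g) {x : X} (hx : x ∈ C) :
    HasConstDisplacement (restrictIsometry g C hg) (dist x (g x)) :=
  fun y => le_antisymm (hC y.2 x) (hC hx y)

theorem dist_pow_of_mem_minSet (g : X ≃ᵢ X) {x : X} (hx : x ∈ minSet g) (n : ℕ) :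
    dist x ((g ^ n) x) = n * dist x (g x) := by
  have hinv : ∀ y, g y ∈ minSet g ↔ y ∈ minSet g :=
    apply_mem_minSet_iff_of_commute (Commute.refl g)
  have := (isCNConvex_minSet g).cnSpace
  have e : ∀ (n : ℕ) (y : minSet g), (((restrictIsometry g _ hinv) ^ n) y : X) = (g ^ n) y := by
    intro n y
    induction n with
    | zero => rfl
    | succ n ih =>
      rw [pow_succ', pow_succ', IsometryEquiv.mul_apply, IsometryEquiv.mul_apply,
        restrictIsometry_apply, ih]
  have h := (hasConstDisplacement_restrict_of_subset g _ hinv subset_rfl hx).pow n ⟨x, hx⟩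
  rw [← h]
  exact congrArg (dist x) (e n ⟨x, hx⟩).symm

/-- On the intersection both isometries, and hence their product, have constant displacement.
Projection to this invariant closed convex set makes the constant a global minimum. -/
theorem minSet_inter_minSet_subset [CompleteSpace X] {g h : X ≃ᵢ X} (hc : Commute g h) :
    minSet g ∩ minSet h ⊆ minSet (g * h) := by
  intro x hx
  set C := minSet g ∩ minSet h with hCdef
  have hg : ∀ y, g y ∈ C ↔ y ∈ C := fun y =>
    and_congr (apply_mem_minSet_iff_of_commute (Commute.refl g) y)
      (apply_mem_minSet_iff_of_commute hc.symm y)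
  have hh : ∀ y, h y ∈ C ↔ y ∈ C := fun y =>
    and_congr (apply_mem_minSet_iff_of_commute hc y)
      (apply_mem_minSet_iff_of_commute (Commute.refl h) y)
  have hC : IsCNConvex C := (isCNConvex_minSet g).inter (isCNConvex_minSet h)
  have := hC.cnSpace
  have : Nonempty C := ⟨⟨x, hx⟩⟩
  obtain ⟨l, hl⟩ := (hasConstDisplacement_restrict_of_subset g C hg inter_subset_left hx).mul
    (hasConstDisplacement_restrict_of_subset h C hh inter_subset_right hx) (by
      ext y
      exact congrArg (fun f : X ≃ᵢ X => f y) hc.eq)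
  refine hC.mem_minSet ((isClosed_minSet g).inter (isClosed_minSet h)) (g * h)
    (fun y => (hg _).trans (hh _)) hx fun y hy => ?_
  exact ((hl ⟨x, hx⟩).trans (hl ⟨y, hy⟩).symm).le

end CN

/-! ### Axes and one-parameter groups of translations -/

section Flow

variable {X : Type*} [MetricSpace X] [CNSpace X]

theorem dist_geodesicPoint_self_le (x y : X) {a b : ℝ} (ha0 : 0 ≤ a) (ha1 : a ≤ 1) (hb0 : 0 ≤ b)
    (hb1 : b ≤ 1) : dist (geodesicPoint x y a) (geodesicPoint x y b) ≤ |a - b| * dist x y := by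
  have h := dist_geodesicPoint_sq_le x y (geodesicPoint x y a) hb0 hb1
  rw [dist_comm _ x, dist_left_geodesicPoint x y ha0 ha1,
    dist_geodesicPoint_right x y ha0 ha1] at h
  refine abs_le_of_sq_le_sq' ?_ (by positivity) |>.2
  rw [mul_pow, sq_abs]
  nlinarith

theorem HasConstDisplacement.nonneg {X : Type*} [MetricSpace X] [Nonempty X] {g : X ≃ᵢ X} {l : ℝ}
    (hg : HasConstDisplacement g l) : 0 ≤ l := by
  obtain ⟨x⟩ := ‹Nonempty X›
  rw [← hg x]; exact dist_nonneg

/-- The geodesic line through the points `g ^ n x`, for `n` an integer. -/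
def orbitLine (g : X ≃ᵢ X) (x : X) (t : ℝ) : X :=
  (g ^ ⌊t⌋) (geodesicPoint x (g x) (Int.fract t))

theorem HasConstDisplacement.dist_zpow {g : X ≃ᵢ X} {l : ℝ} (hg : HasConstDisplacement g l)
    (x : X) {i j : ℤ} (hij : i ≤ j) : dist ((g ^ i) x) ((g ^ j) x) = (j - i) * l := by
  obtain ⟨n, rfl⟩ := Int.le.dest hij
  rw [zpow_add, IsometryEquiv.mul_apply, (g ^ i).dist_eq, zpow_natCast, hg.pow n]
  push_cast
  ring

theorem dist_zpow_orbitLine {g : X ≃ᵢ X} {l : ℝ} (hg : HasConstDisplacement g l) (x : X) (t : ℝ) :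
    dist ((g ^ ⌊t⌋) x) (orbitLine g x t) = Int.fract t * l := by
  rw [orbitLine, (g ^ ⌊t⌋).dist_eq,
    dist_left_geodesicPoint x _ (Int.fract_nonneg t) (Int.fract_lt_one t).le, hg]

theorem dist_orbitLine_zpow {g : X ≃ᵢ X} {l : ℝ} (hg : HasConstDisplacement g l) (x : X) (t : ℝ) :
    dist (orbitLine g x t) ((g ^ (⌊t⌋ + 1)) x) = (1 - Int.fract t) * l := by
  rw [zpow_add, zpow_one, IsometryEquiv.mul_apply, orbitLine, (g ^ ⌊t⌋).dist_eq,
    dist_geodesicPoint_right x _ (Int.fract_nonneg t) (Int.fract_lt_one t).le, hg]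

/-- Distances between the points `g ^ i x` add up exactly, so the triangle inequality through
neighbouring orbit points is sharp in both directions. -/
theorem dist_orbitLine {g : X ≃ᵢ X} {l : ℝ} (hg : HasConstDisplacement g l) (x : X) (s t : ℝ) :
    dist (orbitLine g x s) (orbitLine g x t) = l * |s - t| := by
  wlog hst : s ≤ t generalizing s t
  · rw [dist_comm, abs_sub_comm]
    exact this t s (le_of_not_ge hst)
  have : Nonempty X := ⟨x⟩
  have hl := hg.nonneg
  rw [abs_sub_comm, abs_of_nonneg (sub_nonneg.2 hst)]
  have hs := Int.floor_add_fract s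
  have ht := Int.floor_add_fract t
  have hfl : ⌊s⌋ ≤ ⌊t⌋ := Int.floor_le_floor hst
  have h1 := dist_zpow_orbitLine hg x s
  have h2 := dist_orbitLine_zpow hg x s
  have h3 := dist_zpow_orbitLine hg x t
  have h4 := dist_orbitLine_zpow hg x t
  have hts : t - s = (⌊t⌋ - ⌊s⌋ : ℝ) + Int.fract t - Int.fract s := by linarith
  rw [hts]
  apply le_antisymm
  · rcases hfl.eq_or_lt with h | h
    · rw [orbitLine, orbitLine, h, (g ^ ⌊t⌋).dist_eq]
      refine (dist_geodesicPoint_self_le x (g x) (Int.fract_nonneg s) (Int.fract_lt_one s).le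
        (Int.fract_nonneg t) (Int.fract_lt_one t).le).trans ?_
      have hle : Int.fract s ≤ Int.fract t := by
        rw [h] at hs; linarith
      rw [hg, abs_sub_comm, abs_of_nonneg (sub_nonneg.2 hle)]
      apply le_of_eq
      ring
    · have h5 := hg.dist_zpow x (Int.add_one_le_of_lt h)
      have h6 := dist_triangle4 (orbitLine g x s) ((g ^ (⌊s⌋ + 1)) x) ((g ^ ⌊t⌋) x)
        (orbitLine g x t)
      rw [h2, h5, h3] at h6
      push_cast at h6
      linarith
  · have h5 := hg.dist_zpow x (show ⌊s⌋ ≤ ⌊t⌋ + 1 by omega)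
    have h6 := dist_triangle4 ((g ^ ⌊s⌋) x) (orbitLine g x s) (orbitLine g x t)
        ((g ^ (⌊t⌋ + 1)) x)
    rw [h5, h1, h4] at h6
    push_cast at h6
    linarith

theorem eq_of_eq_on_int {f f' : ℝ → X} {l l' : ℝ} (hf : ∀ s t, dist (f s) (f t) = l * |s - t|)
    (hf' : ∀ s t, dist (f' s) (f' t) = l' * |s - t|) (h : ∀ n : ℤ, f n = f' n) (t : ℝ) :
    f t = f' t := by
  have hpt : ∀ (f : ℝ → X) (l : ℝ), (∀ s t, dist (f s) (f t) = l * |s - t|) →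
      f t = geodesicPoint (f ⌊t⌋) (f (⌊t⌋ + 1 : ℤ)) (Int.fract t) := by
    intro f l hf
    have h0 := Int.fract_nonneg t
    have h1 := Int.fract_lt_one t
    have ht := Int.floor_add_fract t
    have hd : dist (f ⌊t⌋) (f (⌊t⌋ + 1 : ℤ)) = l := by
      rw [hf]; push_cast; simp
    apply eq_geodesicPoint h0 h1.le
    · rw [hf, hd, abs_sub_comm, show t - ⌊t⌋ = Int.fract t from rfl, abs_of_nonneg h0, mul_comm]
    · rw [hf, hd, abs_sub_comm, abs_of_nonneg (by push_cast; linarith)]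
      apply le_of_eq
      push_cast
      rw [mul_comm]
      congr 1
      linarith
  rw [hpt f l hf, hpt f' l' hf', h, h]

theorem orbitLine_int (g : X ≃ᵢ X) (x : X) (n : ℤ) : orbitLine g x n = (g ^ n) x := by
  have : geodesicPoint x (g x) 0 = x := by
    have := dist_left_geodesicPoint x (g x) (t := 0) le_rfl zero_le_one
    rw [zero_mul] at this
    exact (dist_eq_zero.1 this).symm
  rw [orbitLine, Int.floor_intCast, Int.fract_intCast, this]

theorem orbitLine_int_add (g : X ≃ᵢ X) (x : X) (n : ℤ) (t : ℝ) :
    orbitLine g x (n + t) = (g ^ n) (orbitLine g x t) := by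
  rw [orbitLine, orbitLine, Int.floor_intCast_add, Int.fract_intCast_add, zpow_add,
    IsometryEquiv.mul_apply]

theorem orbitLine_orbitLine {g : X ≃ᵢ X} {l : ℝ} (hg : HasConstDisplacement g l) (x : X)
    (s t : ℝ) : orbitLine g (orbitLine g x t) s = orbitLine g x (s + t) := by
  refine eq_of_eq_on_int (f := fun s => orbitLine g (orbitLine g x t) s)
    (f' := fun s => orbitLine g x (s + t)) (l' := l) (dist_orbitLine hg _) (fun s s' => ?_)
    (fun n => ?_) s
  · rw [dist_orbitLine hg, add_sub_add_right_eq_sub]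
  · simp only [orbitLine_int, orbitLine_int_add]

theorem dist_orbitLine_orbitLine_le (g : X ≃ᵢ X) (x y : X) (t : ℝ) :
    dist (orbitLine g x t) (orbitLine g y t) ≤ dist x y := by
  rw [orbitLine, orbitLine, (g ^ ⌊t⌋).dist_eq]
  refine (dist_geodesicPoint_geodesicPoint_le _ _ _ _ (Int.fract_nonneg t)
    (Int.fract_lt_one t).le).trans ?_
  rw [g.dist_eq]
  apply le_of_eq
  ring

/-- The flow moving all points along the axes of an isometry with constant displacement. -/
def axisFlow (g : X ≃ᵢ X) {l : ℝ} (hg : HasConstDisplacement g l) :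
    Multiplicative ℝ →* (X ≃ᵢ X) where
  toFun t :=
    { toFun := fun x => orbitLine g x t.toAdd
      invFun := fun x => orbitLine g x (-t.toAdd)
      left_inv := fun x => by
        beta_reduce
        rw [orbitLine_orbitLine hg, neg_add_cancel]
        simpa using orbitLine_int g x 0
      right_inv := fun x => by
        beta_reduce
        rw [orbitLine_orbitLine hg, add_neg_cancel]
        simpa using orbitLine_int g x 0
      isometry_toFun := Isometry.of_dist_eq fun x y => by
        apply le_antisymm (dist_orbitLine_orbitLine_le g x y _)
        have h := dist_orbitLine_orbitLine_le g (orbitLine g x t.toAdd) (orbitLine g y t.toAdd)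
          (-t.toAdd)
        rw [orbitLine_orbitLine hg, orbitLine_orbitLine hg, neg_add_cancel] at h
        have e : ∀ z, orbitLine g z 0 = z := fun z => by simpa using orbitLine_int g z 0
        rwa [e, e] at h }
  map_one' := by
    ext x
    simpa using orbitLine_int g x 0
  map_mul' s t := by
    ext x
    exact (orbitLine_orbitLine hg x s.toAdd t.toAdd).symm

/-- All orbits of the one-parameter group are geodesic lines of speed `l`. -/
def IsGeodesicFlow {X : Type*} [MetricSpace X] (T : Multiplicative ℝ →* (X ≃ᵢ X)) (l : ℝ) : Prop :=
  ∀ (t : ℝ) (x : X), dist x (T (Multiplicative.ofAdd t) x) = l * |t|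

theorem isGeodesicFlow_axisFlow (g : X ≃ᵢ X) {l : ℝ} (hg : HasConstDisplacement g l) :
    IsGeodesicFlow (axisFlow g hg) l := by
  intro t x
  have h := dist_orbitLine hg x 0 t
  have e : orbitLine g x 0 = x := by simpa using orbitLine_int g x 0
  rw [e, zero_sub, abs_neg] at h
  exact h

theorem axisFlow_one (g : X ≃ᵢ X) {l : ℝ} (hg : HasConstDisplacement g l) :
    axisFlow g hg (Multiplicative.ofAdd 1) = g := by
  ext x
  have h := orbitLine_int g x 1
  rw [Int.cast_one, zpow_one] at h
  exact h

theorem IsGeodesicFlow.dist_eq {X : Type*} [MetricSpace X] {T : Multiplicative ℝ →* (X ≃ᵢ X)}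
    {l : ℝ} (hT : IsGeodesicFlow T l) (x : X) (s t : ℝ) :
    dist (T (Multiplicative.ofAdd s) x) (T (Multiplicative.ofAdd t) x) = l * |s - t| := by
  have : t = s + (t - s) := by ring
  rw [this, ofAdd_add, map_mul, IsometryEquiv.mul_apply, (T _).dist_eq, hT, ← this, abs_sub_comm]

theorem IsGeodesicFlow.hasConstDisplacement {X : Type*} [MetricSpace X]
    {T : Multiplicative ℝ →* (X ≃ᵢ X)} {l : ℝ} (hT : IsGeodesicFlow T l) (t : ℝ) :
    HasConstDisplacement (T (Multiplicative.ofAdd t)) (l * |t|) := hT t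

/-- The orbits are geodesic lines agreeing at integer times, hence equal. This transfers commutation
and conjugation relations from an isometry to its whole axis flow. -/
theorem IsGeodesicFlow.ext {T S : Multiplicative ℝ →* (X ≃ᵢ X)} {l l' : ℝ}
    (hT : IsGeodesicFlow T l) (hS : IsGeodesicFlow S l')
    (h : T (Multiplicative.ofAdd 1) = S (Multiplicative.ofAdd 1)) : T = S := by
  ext t x
  refine eq_of_eq_on_int (f := fun s => T (Multiplicative.ofAdd s) x)
    (f' := fun s => S (Multiplicative.ofAdd s) x) (hT.dist_eq x) (hS.dist_eq x)
    (fun n => ?_) (Multiplicative.toAdd t)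
  have e : ∀ R : Multiplicative ℝ →* (X ≃ᵢ X), R (Multiplicative.ofAdd (n : ℝ)) =
      R (Multiplicative.ofAdd 1) ^ n := by
    intro R
    rw [← map_zpow, ← ofAdd_zsmul, zsmul_one]
  simp only [e, h]

/-- Conjugation of a one-parameter group of isometries. -/
def conjFlow {X : Type*} [MetricSpace X] (h : X ≃ᵢ X) (T : Multiplicative ℝ →* (X ≃ᵢ X)) :
    Multiplicative ℝ →* (X ≃ᵢ X) :=
  (MulAut.conj h).toMonoidHom.comp T

theorem conjFlow_apply {X : Type*} [MetricSpace X] (h : X ≃ᵢ X)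
    (T : Multiplicative ℝ →* (X ≃ᵢ X)) (t : Multiplicative ℝ) :
    conjFlow h T t = h * T t * h⁻¹ := rfl

theorem IsGeodesicFlow.conjFlow {X : Type*} [MetricSpace X] {T : Multiplicative ℝ →* (X ≃ᵢ X)}
    {l : ℝ} (hT : IsGeodesicFlow T l) (h : X ≃ᵢ X) : IsGeodesicFlow (conjFlow h T) l := by
  intro t x
  obtain ⟨y, rfl⟩ := h.surjective x
  rw [conjFlow_apply, IsometryEquiv.mul_apply, IsometryEquiv.inv_apply_self,
    IsometryEquiv.mul_apply, h.dist_eq, hT]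

theorem IsGeodesicFlow.commute {T : Multiplicative ℝ →* (X ≃ᵢ X)} {l : ℝ}
    (hT : IsGeodesicFlow T l) {h : X ≃ᵢ X} (hc : Commute h (T (Multiplicative.ofAdd 1)))
    (t : Multiplicative ℝ) : Commute h (T t) := by
  have : CATZero.conjFlow h T = T := by
    refine (hT.conjFlow h).ext hT ?_
    rw [conjFlow_apply, hc.eq, mul_inv_cancel_right]
  have h2 := DFunLike.congr_fun this t
  rw [conjFlow_apply] at h2
  exact mul_inv_eq_iff_eq_mul.1 h2

/-- The product of two commuting one-parameter groups whose orbits are geodesics. -/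
theorem IsGeodesicFlow.mul [Nonempty X] {T S R : Multiplicative ℝ →* (X ≃ᵢ X)} {a b : ℝ}
    (hT : IsGeodesicFlow T a) (hS : IsGeodesicFlow S b) (hc : ∀ s t, Commute (T s) (S t))
    (hR : ∀ t, R t = T t * S t) : ∃ l, IsGeodesicFlow R l := by
  have hconst : ∀ t : ℝ, ∃ l, HasConstDisplacement (R (Multiplicative.ofAdd t)) l := by
    intro t
    rw [hR]
    exact (hT.hasConstDisplacement t).mul (hS.hasConstDisplacement t) (hc _ _)
  choose f hf using hconst
  have hnat : ∀ (n : ℕ) (t : ℝ), f (n * t) = n * f t := by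
    intro n t
    obtain ⟨x⟩ := ‹Nonempty X›
    have h1 := (hf t).pow n x
    rw [← map_pow, ← ofAdd_nsmul, nsmul_eq_mul, hf] at h1
    exact h1
  have hneg : ∀ t, f (-t) = f t := by
    intro t
    obtain ⟨x⟩ := ‹Nonempty X›
    rw [← hf t x, ← hf (-t) x, ofAdd_neg, map_inv,
      ← (R (Multiplicative.ofAdd t)).dist_eq, IsometryEquiv.apply_inv_self, dist_comm]
  have hadd : ∀ s t, f (s + t) ≤ f s + f t := by
    intro s t
    obtain ⟨x⟩ := ‹Nonempty X›
    rw [← hf (s + t) x, ← hf s x, ← hf t x, ofAdd_add, map_mul, IsometryEquiv.mul_apply]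
    refine (dist_triangle _ (R (Multiplicative.ofAdd s) x) _).trans ?_
    rw [(R (Multiplicative.ofAdd s)).dist_eq]
  -- `f t` is the distance between the points at time `t` on two geodesics issuing from `x`, one
  -- moving along `T`, the other backwards along `S`.
  have hconv : ∀ t, 0 ≤ t → t ≤ 1 → f t ≤ t * f 1 := by
    intro t h0 h1
    obtain ⟨x⟩ := ‹Nonempty X›
    have hpt : ∀ (Q : Multiplicative ℝ →* (X ≃ᵢ X)) (l : ℝ), IsGeodesicFlow Q l →
        ∀ ε : ℝ, |ε| = 1 → Q (Multiplicative.ofAdd (ε * t)) x =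
          geodesicPoint x (Q (Multiplicative.ofAdd ε) x) t := by
      intro Q l hQ ε hε
      apply eq_geodesicPoint h0 h1
      · rw [hQ, hQ, abs_mul, hε, abs_of_nonneg h0]
        apply le_of_eq; ring
      · rw [hQ.dist_eq, hQ, hε, show ε * t - ε = -(ε * (1 - t)) by ring, abs_neg, abs_mul, hε,
          abs_of_nonneg (sub_nonneg.2 h1)]
        apply le_of_eq; ring
    have key : ∀ t : ℝ, f t = dist (T (Multiplicative.ofAdd (1 * t)) x)
        (S (Multiplicative.ofAdd (-1 * t)) x) := by
      intro t
      rw [← hf t x, hR, (hc _ _).eq, IsometryEquiv.mul_apply, one_mul, neg_one_mul, ofAdd_neg,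
        map_inv, ← (S (Multiplicative.ofAdd t)).dist_eq _ ((S (Multiplicative.ofAdd t))⁻¹ x),
        IsometryEquiv.apply_inv_self, dist_comm]
    rw [key t, key 1, hpt T a hT 1 (by simp), hpt S b hS (-1) (by simp), mul_one, mul_one]
    exact dist_geodesicPoint_geodesicPoint_le_of_left _ _ _ h0 h1
  -- The bounds at `t` and `1 - t` sum to `f 1`, so subadditivity turns both into equalities.
  have hunit : ∀ t, 0 ≤ t → t ≤ 1 → f t = t * f 1 := by
    intro t h0 h1
    have h2 := hconv t h0 h1
    have h3 := hconv (1 - t) (by linarith) (by linarith)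
    have h4 := hadd t (1 - t)
    rw [add_sub_cancel] at h4
    linarith
  have hpos : ∀ t, 0 ≤ t → f t = t * f 1 := by
    intro t h0
    obtain ⟨n, hn⟩ := exists_nat_gt t
    have hn0 : (0 : ℝ) < n := lt_of_le_of_lt h0 hn
    have h2 := hnat n (t / n)
    rw [mul_div_cancel₀ _ hn0.ne', hunit (t / n) (by positivity) ((div_le_one hn0).2 hn.le)] at h2
    rw [h2]
    field_simp
  refine ⟨f 1, fun t x => ?_⟩
  rw [hf t x]
  rcases le_total 0 t with h | h
  · rw [hpos t h, abs_of_nonneg h, mul_comm]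
  · rw [← hneg, hpos (-t) (by linarith), abs_of_nonpos h, mul_comm]

end Flow

/-! ### Norms satisfying the parallelogram law -/

section Euclidean

theorem exists_linearEquiv_euclideanSpace {V : Type*} [AddCommGroup V] [Module ℝ V]
    [FiniteDimensional ℝ V] {k : ℕ} (hk : Module.finrank ℝ V = k) (N : V → ℝ)
    (hnonneg : ∀ v, 0 ≤ N v) (hadd : ∀ u v, N (u + v) ≤ N u + N v)
    (hsmul : ∀ (c : ℝ) v, N (c • v) = |c| * N v) (hzero : ∀ v, N v = 0 → v = 0)
    (hpar : ∀ u v, N (u + v) ^ 2 + N (u - v) ^ 2 = 2 * N u ^ 2 + 2 * N v ^ 2) :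
    ∃ L : V ≃ₗ[ℝ] E k, ∀ v, ‖L v‖ = N v := by
  let _ : Norm V := ⟨N⟩
  have core : NormedSpace.Core ℝ V :=
    { norm_nonneg := hnonneg
      norm_smul := hsmul
      norm_triangle := hadd
      norm_eq_zero_iff := fun v => ⟨hzero v, by
        rintro rfl
        have := hsmul 0 0
        rw [zero_smul, abs_zero, zero_mul] at this
        exact this⟩ }
  let _ : NormedAddCommGroup V := NormedAddCommGroup.ofCore core
  let _ : NormedSpace ℝ V := NormedSpace.ofCore core
  let _ : InnerProductSpace ℝ V := InnerProductSpace.ofNorm ℝ fun x y => by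
    have := hpar x y
    change N (x + y) * N (x + y) + N (x - y) * N (x - y) = 2 * (N x * N x + N y * N y)
    linarith
  subst hk
  refine ⟨(stdOrthonormalBasis ℝ V).repr.toLinearEquiv, fun v => ?_⟩
  exact (stdOrthonormalBasis ℝ V).repr.norm_map v

end Euclidean

/-! ### Actions of vector spaces by translations -/

section Translations

variable {X : Type*} [MetricSpace X]

theorem isometryEquiv_one_apply (x : X) : (1 : X ≃ᵢ X) x = x := rfl

/-- The one-parameter subgroup in the direction `u`. -/
def directionFlow {V : Type*} [AddCommGroup V] [Module ℝ V] (T : Multiplicative V →* (X ≃ᵢ X))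
    (u : V) : Multiplicative ℝ →* (X ≃ᵢ X) :=
  T.comp (LinearMap.toSpanSingleton ℝ V u).toAddMonoidHom.toMultiplicative

theorem directionFlow_apply {V : Type*} [AddCommGroup V] [Module ℝ V]
    (T : Multiplicative V →* (X ≃ᵢ X)) (u : V) (t : ℝ) :
    directionFlow T u (Multiplicative.ofAdd t) = T (Multiplicative.ofAdd (t • u)) := rfl

theorem directionFlow_one {V : Type*} [AddCommGroup V] [Module ℝ V]
    (T : Multiplicative V →* (X ≃ᵢ X)) (u : V) :
    directionFlow T u (Multiplicative.ofAdd 1) = T (Multiplicative.ofAdd u) := by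
  rw [directionFlow_apply, one_smul]

theorem commute_of_map {V : Type*} [AddCommGroup V]
    (T : Multiplicative V →* (X ≃ᵢ X)) (u v : Multiplicative V) : Commute (T u) (T v) := by
  rw [commute_iff_eq, ← map_mul, mul_comm, map_mul]

/-- Commuting isometries with constant displacement extend to an action of a vector space whose
one-parameter subgroups move points along geodesic lines. -/
theorem exists_translation_action [CNSpace X] [Nonempty X] {k : ℕ} (a : Fin k → (X ≃ᵢ X))
    (hc : ∀ i j, Commute (a i) (a j)) (ha : ∀ i, ∃ l, HasConstDisplacement (a i) l) :
    ∃ T : Multiplicative (Fin k → ℝ) →* (X ≃ᵢ X),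
      (∀ i, T (Multiplicative.ofAdd (Pi.single i 1)) = a i) ∧
      ∀ u, ∃ l, IsGeodesicFlow (directionFlow T u) l := by
  choose l hl using ha
  set F : Fin k → (Multiplicative ℝ →* (X ≃ᵢ X)) := fun i => axisFlow (a i) (hl i) with hF
  have hFg : ∀ i, IsGeodesicFlow (F i) (l i) := fun i => isGeodesicFlow_axisFlow _ _
  have hF1 : ∀ i, F i (Multiplicative.ofAdd 1) = a i := fun i => axisFlow_one _ _
  have hFc : Pairwise fun i j => ∀ x y, Commute (F i x) (F j y) := by
    intro i j _ x y
    apply (hFg j).commute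
    rw [hF1]
    apply Commute.symm
    apply (hFg i).commute
    rw [hF1]
    exact hc j i
  let ι : Multiplicative (Fin k → ℝ) →* (Fin k → Multiplicative ℝ) :=
    { toFun := fun u i => Multiplicative.ofAdd (Multiplicative.toAdd u i)
      map_one' := rfl
      map_mul' := fun _ _ => rfl }
  set T : Multiplicative (Fin k → ℝ) →* (X ≃ᵢ X) := (MonoidHom.noncommPiCoprod F hFc).comp ι
  have hTs : ∀ i (t : ℝ), T (Multiplicative.ofAdd (Pi.single i t)) =
      F i (Multiplicative.ofAdd t) := by
    intro i t
    rw [← MonoidHom.noncommPiCoprod_mulSingle F (hcomm := hFc) i (Multiplicative.ofAdd t)]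
    change MonoidHom.noncommPiCoprod F hFc (ι (Multiplicative.ofAdd (Pi.single i t))) = _
    congr 1
  refine ⟨T, fun i => by rw [hTs, hF1], fun u => ?_⟩
  have hsum : ∀ (s : Finset (Fin k)) (u : Fin k → ℝ),
      ∃ l, IsGeodesicFlow (directionFlow T (∑ i ∈ s, Pi.single i (u i))) l := by
    intro s u
    induction s using Finset.induction_on with
    | empty =>
      refine ⟨0, fun t x => ?_⟩
      rw [directionFlow_apply, Finset.sum_empty, smul_zero, ofAdd_zero, map_one]
      simp
    | insert i s hi ih =>
      obtain ⟨m, hm⟩ := ih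
      have h1 : IsGeodesicFlow (directionFlow T (Pi.single i (u i))) (l i * |u i|) := by
        intro t x
        rw [directionFlow_apply, ← Pi.single_smul, hTs, hFg i, smul_eq_mul, abs_mul]
        ring
      refine h1.mul hm (fun s t => commute_of_map T _ _) (fun t => ?_)
      rw [Finset.sum_insert hi]
      have : ∀ t : ℝ, directionFlow T (Pi.single i (u i) + ∑ j ∈ s, Pi.single j (u j))
          (Multiplicative.ofAdd t) =
          directionFlow T (Pi.single i (u i)) (Multiplicative.ofAdd t) *
          directionFlow T (∑ j ∈ s, Pi.single j (u j)) (Multiplicative.ofAdd t) := by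
        intro t
        simp only [directionFlow_apply]
        rw [smul_add, ofAdd_add, map_mul]
      exact this (Multiplicative.toAdd t)
  have := hsum Finset.univ u
  rwa [Finset.univ_sum_single] at this

/-- The displacement function of a translation action satisfies the parallelogram law. -/
theorem exists_displacement_norm [CNSpace X] [Nonempty X] {V : Type*} [AddCommGroup V]
    [Module ℝ V] (T : Multiplicative V →* (X ≃ᵢ X))
    (hT : ∀ u, ∃ l, IsGeodesicFlow (directionFlow T u) l) :
    ∃ N : V → ℝ, (∀ u x, dist x (T (Multiplicative.ofAdd u) x) = N u) ∧ (∀ u, 0 ≤ N u) ∧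
      (∀ u v, N (u + v) ≤ N u + N v) ∧ (∀ (c : ℝ) u, N (c • u) = |c| * N u) ∧
      ∀ u v, N (u + v) ^ 2 + N (u - v) ^ 2 = 2 * N u ^ 2 + 2 * N v ^ 2 := by
  choose N hN using hT
  have hd : ∀ u x, dist x (T (Multiplicative.ofAdd u) x) = N u := by
    intro u x
    have := hN u 1 x
    rwa [directionFlow_one, abs_one, mul_one] at this
  obtain ⟨x⟩ := ‹Nonempty X›
  have hsmul : ∀ (c : ℝ) u, N (c • u) = |c| * N u := by
    intro c u
    rw [← hd (c • u) x, ← directionFlow_apply, hN u, mul_comm]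
  have hpar : ∀ u v, N (u + v) ^ 2 + N (u - v) ^ 2 ≤ 2 * N u ^ 2 + 2 * N v ^ 2 := by
    intro u v
    have h := dist_sq_add_dist_sq_le x (T (Multiplicative.ofAdd u) x)
      (T (Multiplicative.ofAdd (u + v)) x) (T (Multiplicative.ofAdd v) x)
    have e1 : dist (T (Multiplicative.ofAdd u) x) (T (Multiplicative.ofAdd (u + v)) x) = N v := by
      rw [ofAdd_add, map_mul, IsometryEquiv.mul_apply, IsometryEquiv.dist_eq, hd]
    have e2 : dist (T (Multiplicative.ofAdd (u + v)) x) (T (Multiplicative.ofAdd v) x) = N u := by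
      rw [add_comm, ofAdd_add, map_mul, IsometryEquiv.mul_apply, IsometryEquiv.dist_eq, dist_comm,
        hd]
    have e3 : dist (T (Multiplicative.ofAdd u) x) (T (Multiplicative.ofAdd v) x) = N (u - v) := by
      have : u = v + (u - v) := by abel
      rw [this, ofAdd_add, map_mul, IsometryEquiv.mul_apply, IsometryEquiv.dist_eq, dist_comm,
        hd, ← this]
    rw [e1, e2, e3, dist_comm _ x, hd, hd, hd] at h
    linarith
  refine ⟨N, hd, fun u => by rw [← hd u x]; exact dist_nonneg, fun u v => ?_, hsmul,
    fun u v => le_antisymm (hpar u v) ?_⟩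
  · rw [← hd (u + v) x, ← hd u x, ← hd v x, ofAdd_add, map_mul, IsometryEquiv.mul_apply]
    refine (dist_triangle _ (T (Multiplicative.ofAdd u) x) _).trans ?_
    rw [IsometryEquiv.dist_eq]
  -- The four-point inequality gives one half of the parallelogram law; applied to `u + v` and `u -
  -- v` it gives the other.
  · have h := hpar (u + v) (u - v)
    have e1 : u + v + (u - v) = (2 : ℝ) • u := by rw [two_smul]; abel
    have e2 : u + v - (u - v) = (2 : ℝ) • v := by rw [two_smul]; abel
    rw [e1, e2, hsmul, hsmul, abs_two] at h
    linarith

/-! ### Splitting -/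

/-- Jensen's equation makes `G - G 0` additive, hence linear by continuity. The factor `-2` matches
the expansion of `‖u - b‖ ^ 2`. -/
theorem exists_inner_of_jensen {V : Type*} [NormedAddCommGroup V] [InnerProductSpace ℝ V]
    [FiniteDimensional ℝ V] (G : V → ℝ) (hG : Continuous G)
    (hJ : ∀ u h, G (u + h) + G (u - h) = 2 * G u) :
    ∃ b : V, ∀ u, G u = G 0 - 2 * inner ℝ b u := by
  have hhalf : ∀ u, G ((2 : ℝ)⁻¹ • u) = (G u + G 0) / 2 := by
    intro u
    have h := hJ ((2 : ℝ)⁻¹ • u) ((2 : ℝ)⁻¹ • u)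
    rw [sub_self, ← add_smul] at h
    norm_num at h
    linarith
  let g : V →+ ℝ :=
    { toFun := fun u => G u - G 0
      map_zero' := sub_self _
      map_add' := fun u v => by
        have h := hJ ((2 : ℝ)⁻¹ • (u + v)) ((2 : ℝ)⁻¹ • (u - v))
        have e1 : (2 : ℝ)⁻¹ • (u + v) + (2 : ℝ)⁻¹ • (u - v) = u := by
          rw [← smul_add, show u + v + (u - v) = (2 : ℝ) • u by rw [two_smul]; abel, smul_smul]
          norm_num
        have e2 : (2 : ℝ)⁻¹ • (u + v) - (2 : ℝ)⁻¹ • (u - v) = v := by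
          rw [← smul_sub, show u + v - (u - v) = (2 : ℝ) • v by rw [two_smul]; abel, smul_smul]
          norm_num
        rw [e1, e2, hhalf] at h
        linarith }
  have hg : Continuous g := hG.sub continuous_const
  let gl : V →L[ℝ] ℝ := g.toRealLinearMap hg
  refine ⟨-(2 : ℝ)⁻¹ • (InnerProductSpace.toDual ℝ V).symm gl, fun u => ?_⟩
  rw [inner_smul_left, InnerProductSpace.toDual_symm_apply]
  have : gl u = G u - G 0 := rfl
  rw [this]
  simp

variable [CNSpace X] {V : Type*} [NormedAddCommGroup V] [InnerProductSpace ℝ V]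
  [FiniteDimensional ℝ V]

/-- After subtracting `‖u‖ ^ 2`, the squared distance satisfies Jensen's equation: the Bruhat–Tits
inequality at a midpoint of an orbit line gives one direction, and the quadrilateral `x`, `T h x`,
`T (u + h) y`, `T u y` the other. The vector `b` is the future difference of the `V`-coordinates of
`x` and `y`. -/
theorem exists_inner_of_translations (T : Multiplicative V →* (X ≃ᵢ X))
    (hT : ∀ u x, dist x (T (Multiplicative.ofAdd u) x) = ‖u‖) (x y : X) :
    ∃ b : V, ∀ u, dist x (T (Multiplicative.ofAdd u) y) ^ 2 =
      ‖u‖ ^ 2 - 2 * inner ℝ b u + dist x y ^ 2 := by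
  set F : V → ℝ := fun u => dist x (T (Multiplicative.ofAdd u) y) with hF
  have hTT : ∀ u v z, dist (T (Multiplicative.ofAdd u) z) (T (Multiplicative.ofAdd v) z) =
      ‖u - v‖ := by
    intro u v z
    have : u = v + (u - v) := by abel
    rw [this, ofAdd_add, map_mul, IsometryEquiv.mul_apply, IsometryEquiv.dist_eq, dist_comm, hT,
      ← this]
  have hFc : Continuous F := by
    have : Continuous fun u : V => T (Multiplicative.ofAdd u) y :=
      (Isometry.of_dist_eq fun u v => by rw [hTT, dist_eq_norm]).continuous
    exact continuous_const.dist this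
  obtain ⟨b, hb⟩ := exists_inner_of_jensen (fun u => F u ^ 2 - ‖u‖ ^ 2)
    ((hFc.pow 2).sub (continuous_norm.pow 2)) (fun u h => by
      have hp := parallelogram_law_with_norm ℝ u h
      have hmid : T (Multiplicative.ofAdd u) y = geodesicPoint (T (Multiplicative.ofAdd (u - h)) y)
          (T (Multiplicative.ofAdd (u + h)) y) (1 / 2) := by
        have e0 : ‖u - h - (u + h)‖ = 2 * ‖h‖ := by
          rw [show u - h - (u + h) = -((2 : ℝ) • h) by rw [two_smul]; abel, norm_neg, norm_smul]
          norm_num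
        apply eq_geodesicPoint (by norm_num) (by norm_num)
        · rw [hTT, hTT, e0, show u - h - u = -h by abel, norm_neg]
          linarith
        · rw [hTT, hTT, e0, show u - (u + h) = -h by abel, norm_neg]
          linarith
      have h1 := dist_geodesicPoint_sq_le (T (Multiplicative.ofAdd (u - h)) y)
          (T (Multiplicative.ofAdd (u + h)) y) x (t := 1 / 2) (by norm_num) (by norm_num)
      rw [← hmid, hTT, show u - h - (u + h) = -((2 : ℝ) • h) by rw [two_smul]; abel, norm_neg,
        norm_smul, Real.norm_two] at h1
      have h2 := dist_sq_add_dist_sq_le x (T (Multiplicative.ofAdd h) x)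
        (T (Multiplicative.ofAdd (u + h)) y) (T (Multiplicative.ofAdd u) y)
      have e1 : dist (T (Multiplicative.ofAdd h) x) (T (Multiplicative.ofAdd (u + h)) y) = F u := by
        rw [add_comm, ofAdd_add, map_mul, IsometryEquiv.mul_apply, IsometryEquiv.dist_eq]
      have e2 : dist (T (Multiplicative.ofAdd h) x) (T (Multiplicative.ofAdd u) y) =
          F (u - h) := by
        have : u = h + (u - h) := by abel
        rw [this, ofAdd_add, map_mul, IsometryEquiv.mul_apply, IsometryEquiv.dist_eq, ← this]
      rw [e1, e2, hT, hTT, show u + h - u = h by abel,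
        dist_comm (T (Multiplicative.ofAdd u) y) x] at h2
      simp only [hF] at h2 ⊢
      nlinarith)
  refine ⟨b, fun u => ?_⟩
  have h := hb u
  simp only [hF] at h
  rw [ofAdd_zero, map_one, norm_zero, isometryEquiv_one_apply] at h
  linarith

/-- The Busemann functions of a translation action form a cocycle. -/
theorem exists_height (T : Multiplicative V →* (X ≃ᵢ X))
    (hT : ∀ u x, dist x (T (Multiplicative.ofAdd u) x) = ‖u‖) [Nonempty X] :
    ∃ β : X → V, (∀ u x, β (T (Multiplicative.ofAdd u) x) = β x + u) ∧
      ∀ x y u, dist x (T (Multiplicative.ofAdd u) y) ^ 2 =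
        ‖u‖ ^ 2 - 2 * inner ℝ (β x - β y) u + dist x y ^ 2 := by
  choose b hb using exists_inner_of_translations T hT
  have hcoc : ∀ x y z, b x z = b x y + b y z := by
    intro x y z
    have key : ∀ h : V, inner ℝ (b x y + b y z - b x z) h = 0 := by
      intro h
      set D := inner ℝ (b x y + b y z - b x z) h with hD
      have hD' : D = inner ℝ (b x y) h + inner ℝ (b y z) h - inner ℝ (b x z) h := by
        rw [hD, inner_sub_left, inner_add_left]
      -- Going from `x` to `T (2th) z` through `T (th) y`, the terms quadratic in `t` cancel. A
      -- linear function of `t` bounded above on all of `ℝ` has slope `0`.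
      have h1 : ∀ t : ℝ, 4 * t * D ≤ 2 * dist x y ^ 2 + 2 * dist y z ^ 2 - dist x z ^ 2 := by
        intro t
        have e1 := hb x z ((2 * t) • h)
        have e2 := hb x y (t • h)
        have e3 := hb y z (t • h)
        have e4 : dist x (T (Multiplicative.ofAdd ((2 * t) • h)) z) ≤
            dist x (T (Multiplicative.ofAdd (t • h)) y) +
              dist y (T (Multiplicative.ofAdd (t • h)) z) := by
          refine (dist_triangle _ (T (Multiplicative.ofAdd (t • h)) y) _).trans ?_
          rw [two_mul, add_smul, ofAdd_add, map_mul, IsometryEquiv.mul_apply,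
            IsometryEquiv.dist_eq]
        have e5 := pow_le_pow_left₀ dist_nonneg e4 2
        have e6 := sq_nonneg (dist x (T (Multiplicative.ofAdd (t • h)) y) -
              dist y (T (Multiplicative.ofAdd (t • h)) z))
        rw [norm_smul, inner_smul_right] at e1 e2 e3
        rw [Real.norm_eq_abs, mul_pow, sq_abs] at e1 e2 e3
        rw [hD']
        nlinarith
      by_contra hne
      have := h1 ((2 * dist x y ^ 2 + 2 * dist y z ^ 2 - dist x z ^ 2 + 1) / (4 * D))
      have h2 : 4 * ((2 * dist x y ^ 2 + 2 * dist y z ^ 2 - dist x z ^ 2 + 1) / (4 * D)) * D =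
          2 * dist x y ^ 2 + 2 * dist y z ^ 2 - dist x z ^ 2 + 1 := by
        field_simp
      linarith
    have := key (b x y + b y z - b x z)
    rw [inner_self_eq_zero, sub_eq_zero] at this
    exact this.symm
  obtain ⟨o⟩ := ‹Nonempty X›
  refine ⟨fun x => b x o, fun u x => ?_, fun x y u => ?_⟩
  · rw [← sub_eq_zero, ← inner_self_eq_zero (𝕜 := ℝ)]
    have key : ∀ v, inner ℝ (b (T (Multiplicative.ofAdd u) x) o - (b x o + u)) v = 0 := by
      intro v
      have e1 := hb (T (Multiplicative.ofAdd u) x) o v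
      have e2 := hb x o (v - u)
      have e3 := hb x o (-u)
      have e4 : ∀ w, dist (T (Multiplicative.ofAdd u) x) (T (Multiplicative.ofAdd w) o) =
          dist x (T (Multiplicative.ofAdd (w - u)) o) := by
        intro w
        have : w = u + (w - u) := by abel
        rw [this, ofAdd_add, map_mul, IsometryEquiv.mul_apply, IsometryEquiv.dist_eq, ← this]
      have e5 := e4 0
      rw [ofAdd_zero, map_one, isometryEquiv_one_apply, zero_sub] at e5
      rw [e4, e5, e2, e3, norm_sub_sq_real, norm_neg, inner_sub_right, inner_neg_right] at e1
      rw [inner_sub_left, inner_add_left, real_inner_comm v u]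
      linarith
    exact key _
  · beta_reduce
    rw [hb x y u, hcoc x y o, add_sub_cancel_right]

end Translations

/-! ### Splitting off a Euclidean factor -/

section Product

theorem dist_sq_withLp {A B : Type*} [MetricSpace A] [MetricSpace B] (p q : WithLp 2 (A × B)) :
    dist p q ^ 2 = dist p.fst q.fst ^ 2 + dist p.snd q.snd ^ 2 := by
  rw [WithLp.prod_dist_eq_add (by norm_num)]
  rw [← Real.rpow_natCast, ← Real.rpow_mul (by positivity)]
  simp

theorem isometry_of_dist_sq {A B : Type*} [PseudoMetricSpace A] [PseudoMetricSpace B] {f : A → B}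
    (h : ∀ x y, dist (f x) (f y) ^ 2 = dist x y ^ 2) : Isometry f :=
  Isometry.of_dist_eq fun x y => by
    have := h x y
    rwa [sq_eq_sq₀ dist_nonneg dist_nonneg] at this

variable {X : Type u} [MetricSpace X] [CNSpace X] {V : Type} [NormedAddCommGroup V]
  [InnerProductSpace ℝ V] [FiniteDimensional ℝ V]

/-- A space with an action of a Euclidean space by translations splits off that space. -/
theorem exists_product_decomposition [Nonempty X] (T : Multiplicative V →* (X ≃ᵢ X))
    (hT : ∀ u x, dist x (T (Multiplicative.ofAdd u) x) = ‖u‖) :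
    ∃ (W : Set X) (φ : WithLp 2 (W × V) → X), W.Nonempty ∧ CNSpace W ∧ Isometry φ ∧
      Function.Surjective φ ∧
      (∀ (w : W) (u : V), φ (WithLp.toLp 2 (w, u)) = T (Multiplicative.ofAdd u) w) ∧
      ∀ (h : X ≃ᵢ X) (α : V → V), Function.Surjective α →
        (∀ u, h * T (Multiplicative.ofAdd u) = T (Multiplicative.ofAdd (α u)) * h) →
        ∃ (r : W → W) (t : V), ∀ (w : W) (u : V),
          h (φ (WithLp.toLp 2 (w, u))) = φ (WithLp.toLp 2 (r w, α u + t)) := by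
  obtain ⟨β, hβ, hd⟩ := exists_height T hT
  set W : Set X := {x | β x = 0} with hW
  have hWβ : ∀ w : W, β w = 0 := fun w => w.2
  have hproj : ∀ x, T (Multiplicative.ofAdd (-β x)) x ∈ W := by
    intro x
    change β _ = 0
    rw [hβ, add_neg_cancel]
  have hTneg : ∀ u x, T (Multiplicative.ofAdd u) (T (Multiplicative.ofAdd (-u)) x) = x := by
    intro u x
    rw [← IsometryEquiv.mul_apply, ← map_mul, ← ofAdd_add, add_neg_cancel, ofAdd_zero, map_one]
    rfl
  have hWd : ∀ (w w' : W) u, dist (w : X) (T (Multiplicative.ofAdd u) w') ^ 2 =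
      ‖u‖ ^ 2 + dist (w : X) w' ^ 2 := by
    intro w w' u
    rw [hd, hWβ, hWβ, sub_zero, inner_zero_left, mul_zero, sub_zero]
  have hne : W.Nonempty := by
    obtain ⟨x⟩ := ‹Nonempty X›
    exact ⟨_, hproj x⟩
  refine ⟨W, fun p => T (Multiplicative.ofAdd p.snd) p.fst, hne, ?_, ?_, ?_, fun w u => rfl, ?_⟩
  -- Moving the geodesic point into `W` along the flow can only decrease its distance to points of
  -- `W`, by Pythagoras.
  · refine ⟨fun x y t ht => ?_⟩
    set p := geodesicPoint (x : X) y t with hp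
    refine ⟨⟨_, hproj p⟩, fun z => ?_⟩
    have h1 := dist_geodesicPoint_sq_le (x : X) y z ht.1 ht.2
    have h2 := hWd z ⟨_, hproj p⟩ (β p)
    rw [hTneg] at h2
    have h3 := sq_nonneg ‖β p‖
    rw [← hp] at h1
    rw [Subtype.dist_eq, Subtype.dist_eq z x, Subtype.dist_eq z y, Subtype.dist_eq x y]
    linarith
  · apply isometry_of_dist_sq
    intro p q
    rw [dist_sq_withLp, Subtype.dist_eq]
    have : q.snd = p.snd + (q.snd - p.snd) := by abel
    rw [this, ofAdd_add, map_mul, IsometryEquiv.mul_apply, IsometryEquiv.dist_eq, hWd, ← this,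
      add_comm, dist_comm p.snd, dist_eq_norm]
  · intro x
    exact ⟨WithLp.toLp 2 (⟨_, hproj x⟩, β x), hTneg _ _⟩
  · intro h α hα hcomm
    have happ : ∀ u x, h (T (Multiplicative.ofAdd u) x) = T (Multiplicative.ofAdd (α u)) (h x) :=
      fun u x => congrArg (fun f : X ≃ᵢ X => f x) (hcomm u)
    have hnorm : ∀ u, ‖α u‖ = ‖u‖ := by
      intro u
      obtain ⟨x, -⟩ := hne
      rw [← hT (α u) (h x), ← happ, h.dist_eq, hT]
    -- An isometry normalizing the translations maps level sets of the height to level sets: the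
    -- difference of heights is orthogonal to every `α v`, and `α` is surjective.
    have hconst : ∀ w w' : W, β (h w) = β (h w') := by
      intro w w'
      rw [← sub_eq_zero]
      have key : ∀ v, inner ℝ (β (h w) - β (h w')) (α v) = 0 := by
        intro v
        have h1 := hd (h w) (h w') (α v)
        rw [← happ, h.dist_eq, h.dist_eq, hWd, hnorm] at h1
        linarith
      obtain ⟨v, hv⟩ := hα (β (h w) - β (h w'))
      have := key v
      rwa [hv, inner_self_eq_zero] at this
    obtain ⟨w₀, hw₀⟩ := hne
    set t := β (h w₀)
    refine ⟨fun w => ⟨T (Multiplicative.ofAdd (-β (h w))) (h w), hproj _⟩, t, fun w u => ?_⟩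
    change h (T (Multiplicative.ofAdd u) w) = T (Multiplicative.ofAdd (α u + t))
      (T (Multiplicative.ofAdd (-β (h w))) (h w))
    rw [happ, ofAdd_add, map_mul, IsometryEquiv.mul_apply]
    congr 1
    rw [hconst w ⟨w₀, hw₀⟩, hTneg]

/-- Groups acting componentwise, element by element, act through homomorphisms to the isometry
groups of the factors. -/
theorem exists_component_homs {Y W V G : Type*} [MetricSpace Y] [MetricSpace W] [MetricSpace V]
    [Nonempty W] [Nonempty V] [Group G] (act : G →* (Y ≃ᵢ Y)) (φ : WithLp 2 (W × V) → Y)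
    (hφ : Isometry φ)
    (h : ∀ g, ∃ (r : W → W) (s : V → V), ∀ w u,
      act g (φ (WithLp.toLp 2 (w, u))) = φ (WithLp.toLp 2 (r w, s u))) :
    ∃ (ρ : G →* (W ≃ᵢ W)) (σ : G →* (V ≃ᵢ V)), ∀ g w u,
      act g (φ (WithLp.toLp 2 (w, u))) = φ (WithLp.toLp 2 (ρ g w, σ g u)) := by
  choose r s hrs using h
  obtain ⟨w₀⟩ := ‹Nonempty W›
  obtain ⟨u₀⟩ := ‹Nonempty V›
  have hinj : ∀ {w w' : W} {u u' : V}, φ (WithLp.toLp 2 (w, u)) = φ (WithLp.toLp 2 (w', u')) →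
      w = w' ∧ u = u' := by
    intro w w' u u' h
    have h1 := hφ.injective h
    exact ⟨congrArg WithLp.fst h1, congrArg WithLp.snd h1⟩
  have hmul : ∀ g g' w u, r (g * g') w = r g (r g' w) ∧ s (g * g') u = s g (s g' u) := by
    intro g g' w u
    apply hinj
    rw [← hrs, ← hrs, ← hrs, map_mul, IsometryEquiv.mul_apply]
  have hone : ∀ w u, r 1 w = w ∧ s 1 u = u := by
    intro w u
    apply hinj
    rw [← hrs, map_one]
    rfl
  have hdist : ∀ g w u w' u', dist (r g w) (r g w') ^ 2 + dist (s g u) (s g u') ^ 2 =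
      dist w w' ^ 2 + dist u u' ^ 2 := by
    intro g w u w' u'
    have h1 := dist_sq_withLp (WithLp.toLp 2 (r g w, s g u)) (WithLp.toLp 2 (r g w', s g u'))
    have h2 := dist_sq_withLp (WithLp.toLp 2 (w, u)) (WithLp.toLp 2 (w', u'))
    rw [← hφ.dist_eq, ← hrs, ← hrs, (act g).dist_eq, hφ.dist_eq, h2] at h1
    exact h1.symm
  let ρ : G →* (W ≃ᵢ W) :=
    { toFun := fun g =>
        { toFun := r g
          invFun := r g⁻¹
          left_inv := fun w => by rw [← (hmul _ _ w u₀).1, inv_mul_cancel, (hone w u₀).1]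
          right_inv := fun w => by rw [← (hmul _ _ w u₀).1, mul_inv_cancel, (hone w u₀).1]
          isometry_toFun := isometry_of_dist_sq fun w w' => by
            simpa using hdist g w u₀ w' u₀ }
      map_one' := by ext w; exact (hone w u₀).1
      map_mul' := fun g g' => by ext w; exact (hmul g g' w u₀).1 }
  let σ : G →* (V ≃ᵢ V) :=
    { toFun := fun g =>
        { toFun := s g
          invFun := s g⁻¹
          left_inv := fun u => by rw [← (hmul _ _ w₀ u).2, inv_mul_cancel, (hone w₀ u).2]
          right_inv := fun u => by rw [← (hmul _ _ w₀ u).2, mul_inv_cancel, (hone w₀ u).2]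
          isometry_toFun := isometry_of_dist_sq fun u u' => by
            simpa using hdist g w₀ u w₀ u' }
      map_one' := by ext u; exact (hone w₀ u).2
      map_mul' := fun g g' => by ext u; exact (hmul g g' w₀ u).2 }
  exact ⟨ρ, σ, hrs⟩

end Product

/-! ### Discrete groups of translations as lattices -/

section Lattice

/-- A seminorm on `ℝᵏ` with finitely many bounded integer points is a norm. -/
theorem eq_zero_of_finite_integer_points {k : ℕ} (N : (Fin k → ℝ) → ℝ)
    (hnonneg : ∀ u, 0 ≤ N u) (hadd : ∀ u v, N (u + v) ≤ N u + N v)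
    (hsmul : ∀ (c : ℝ) u, N (c • u) = |c| * N u)
    (hfin : ∀ η : ℝ, {n : Fin k → ℤ | N (fun i => (n i : ℝ)) < η}.Finite) {u : Fin k → ℝ}
    (hu : N u = 0) : u = 0 := by
  have hsum : ∀ (s : Finset (Fin k)) (v : Fin k → ℝ), (∀ i, |v i| ≤ 1) →
      N (∑ i ∈ s, Pi.single i (v i)) ≤ ∑ i ∈ s, N (Pi.single i 1) := by
    intro s v hv
    induction s using Finset.induction_on with
    | empty =>
      have := hsmul 0 0
      rw [zero_smul, abs_zero, zero_mul] at this
      simp [this]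
    | insert i s hi ih =>
      rw [Finset.sum_insert hi, Finset.sum_insert hi]
      refine (hadd _ _).trans (add_le_add ?_ ih)
      have : (Pi.single i (v i) : Fin k → ℝ) = v i • Pi.single i 1 := by
        rw [← Pi.single_smul, smul_eq_mul, mul_one]
      rw [this, hsmul]
      exact mul_le_of_le_one_left (hnonneg _) (hv i)
  set K := ∑ i, N (Pi.single i 1) with hK
  -- These integer points differ from the null vectors `m • u` by fractional parts, so `N` is at
  -- most `K` on them; but a coordinate with `u i ≠ 0` makes infinitely many of them distinct.
  set f : ℕ → (Fin k → ℤ) := fun m i => ⌊(m : ℝ) * u i⌋ with hf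
  have hmem : ∀ m, f m ∈ {n : Fin k → ℤ | N (fun i => (n i : ℝ)) < K + 1} := by
    intro m
    have e : (fun i => ((f m i : ℤ) : ℝ)) =
        (m : ℝ) • u + ∑ i, Pi.single i (-Int.fract ((m : ℝ) * u i)) := by
      rw [Finset.univ_sum_single]
      ext i
      simp only [hf, Pi.add_apply, Pi.smul_apply, smul_eq_mul]
      linarith [Int.floor_add_fract ((m : ℝ) * u i)]
    change N _ < _
    rw [e]
    refine lt_of_le_of_lt (hadd _ _) ?_
    rw [hsmul, hu, mul_zero, zero_add]
    refine lt_of_le_of_lt (hsum _ _ fun i => ?_) (lt_add_one K)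
    rw [abs_neg, abs_of_nonneg (Int.fract_nonneg _)]
    exact (Int.fract_lt_one _).le
  by_contra hne
  obtain ⟨i, hi⟩ := Function.ne_iff.1 hne
  have hfinr : (Set.range f).Finite := (hfin (K + 1)).subset (by rintro _ ⟨m, rfl⟩; exact hmem m)
  have hfini : (Set.range fun m => f m i).Finite := by
    have := hfinr.image (fun n => n i)
    rwa [← Set.range_comp] at this
  obtain ⟨B, hB⟩ : ∃ B : ℤ, ∀ m, |f m i| ≤ B := by
    obtain ⟨B, hB⟩ := (hfini.image (fun n => |n|)).bddAbove
    exact ⟨B, fun m => hB ⟨_, ⟨m, rfl⟩, rfl⟩⟩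
  have hpos : 0 < |u i| := abs_pos.2 hi
  obtain ⟨m, hm⟩ := exists_nat_gt ((B + 1 : ℝ) / |u i|)
  rw [div_lt_iff₀ hpos] at hm
  have h1 : |(f m i : ℝ)| ≤ B := by exact_mod_cast hB m
  have h2 : (m : ℝ) * u i = f m i + Int.fract ((m : ℝ) * u i) := (Int.floor_add_fract _).symm
  have h3 : (m : ℝ) * |u i| ≤ |(f m i : ℝ)| + 1 := by
    rw [← Nat.abs_cast m, ← abs_mul, h2]
    refine (abs_add_le _ _).trans ?_
    rw [abs_of_nonneg (Int.fract_nonneg ((m : ℝ) * u i))]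
    linarith [Int.fract_lt_one ((m : ℝ) * u i)]
  linarith

variable {X : Type u} [MetricSpace X] [CNSpace X]

/-- A discrete group of commuting isometries with constant displacement acts as a lattice in a
Euclidean space of translations. -/
theorem exists_euclidean_translation_action [Nonempty X] {k : ℕ}
    (e : Multiplicative (Fin k → ℤ) →* (X ≃ᵢ X))
    (he : ∀ n, ∃ l, HasConstDisplacement (e n) l)
    (hdisc : ∀ (x : X) (η : ℝ),
      {n : Fin k → ℤ | dist x (e (Multiplicative.ofAdd n) x) < η}.Finite) :
    ∃ (T : Multiplicative (E k) →* (X ≃ᵢ X)) (v : Module.Basis (Fin k) ℝ (E k)),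
      (∀ u x, dist x (T (Multiplicative.ofAdd u) x) = ‖u‖) ∧
      (∀ n : Fin k → ℤ, e (Multiplicative.ofAdd n) =
        T (Multiplicative.ofAdd (∑ i, (n i : ℝ) • v i))) ∧
      (∀ h : X ≃ᵢ X, (∀ n, Commute h (e n)) → ∀ u, Commute h (T u)) ∧
      ∀ h : X ≃ᵢ X, (∀ n, ∃ m, h * e n = e m * h) → (∀ n, ∃ m, h⁻¹ * e n = e m * h⁻¹) →
        ∃ α : E k → E k, Function.Surjective α ∧
          ∀ u, h * T (Multiplicative.ofAdd u) = T (Multiplicative.ofAdd (α u)) * h := by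
  obtain ⟨S, hS1, hSf⟩ := exists_translation_action
    (fun i => e (Multiplicative.ofAdd (Pi.single i 1))) (fun i j => commute_of_map e _ _)
    (fun i => he _)
  obtain ⟨N, hN, hN0, hNadd, hNsmul, hNpar⟩ := exists_displacement_norm S hSf
  have hSe : ∀ n : Fin k → ℤ, e (Multiplicative.ofAdd n) =
      S (Multiplicative.ofAdd fun i => (n i : ℝ)) := by
    intro n
    let cast : Multiplicative (Fin k → ℤ) →* Multiplicative (Fin k → ℝ) :=
      { toFun := fun n => Multiplicative.ofAdd fun i => ((Multiplicative.toAdd n i : ℤ) : ℝ)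
        map_one' := by
          apply Multiplicative.toAdd.injective
          ext i
          exact Int.cast_zero
        map_mul' := fun a b => by
          apply Multiplicative.toAdd.injective
          ext i
          exact Int.cast_add _ _ }
    have hext : ∀ (f f' : Multiplicative (Fin k → ℤ) →* (X ≃ᵢ X)),
        (∀ i, f (Multiplicative.ofAdd (Pi.single i 1)) =
          f' (Multiplicative.ofAdd (Pi.single i 1))) → f = f' := by
      intro f f' h
      have hs : ∀ (s : Finset (Fin k)) (n : Fin k → ℤ),
          f (Multiplicative.ofAdd (∑ i ∈ s, Pi.single i (n i))) =
          f' (Multiplicative.ofAdd (∑ i ∈ s, Pi.single i (n i))) := by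
        intro s n
        induction s using Finset.induction_on with
        | empty => rw [Finset.sum_empty, ofAdd_zero, map_one, map_one]
        | insert i s hi ih =>
          rw [Finset.sum_insert hi, ofAdd_add, map_mul, map_mul, ih]
          have : (Pi.single i (n i) : Fin k → ℤ) = n i • Pi.single i 1 := by
            rw [← Pi.single_smul, smul_eq_mul, mul_one]
          rw [this, ofAdd_zsmul, map_zpow, map_zpow, h]
      refine MonoidHom.ext fun n => ?_
      have := hs Finset.univ (Multiplicative.toAdd n)
      rwa [Finset.univ_sum_single] at this
    refine DFunLike.congr_fun (hext e (S.comp cast) fun i => ?_) (Multiplicative.ofAdd n)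
    rw [← hS1]
    change _ = S (cast _)
    congr 1
    apply Multiplicative.toAdd.injective
    ext j
    change _ = (((Pi.single i 1 : Fin k → ℤ) j : ℤ) : ℝ)
    by_cases h : j = i
    · subst h; simp
    · simp [h]
  have hNzero : ∀ v, N v = 0 → v = 0 := by
    intro v hv
    refine eq_zero_of_finite_integer_points N hN0 hNadd hNsmul (fun η => ?_) hv
    obtain ⟨x⟩ := ‹Nonempty X›
    refine (hdisc x η).subset fun n hn => ?_
    change dist x _ < η
    rw [hSe, hN]
    exact hn
  obtain ⟨L, hL⟩ := exists_linearEquiv_euclideanSpace (k := k) (by simp) N hN0 hNadd hNsmul hNzero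
    hNpar
  set T : Multiplicative (E k) →* (X ≃ᵢ X) :=
    S.comp L.symm.toLinearMap.toAddMonoidHom.toMultiplicative with hTdef
  have hTS : ∀ u, T (Multiplicative.ofAdd u) = S (Multiplicative.ofAdd (L.symm u)) := fun _ => rfl
  set v : Module.Basis (Fin k) ℝ (E k) := (Pi.basisFun ℝ (Fin k)).map L with hv
  have hvi : ∀ i, L.symm (v i) = Pi.single i 1 := by
    intro i
    simp [hv]
  have hTd : ∀ u x, dist x (T (Multiplicative.ofAdd u) x) = ‖u‖ := by
    intro u x
    rw [hTS, hN, ← hL, L.apply_symm_apply]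
  have hTe : ∀ n : Fin k → ℤ, e (Multiplicative.ofAdd n) =
        T (Multiplicative.ofAdd (∑ i, (n i : ℝ) • v i)) := by
    intro n
    rw [hSe, hTS, map_sum]
    simp only [map_smul, hvi]
    congr 2
    have := Finset.univ_sum_single (fun i => (n i : ℝ))
    rw [← this]
    refine Finset.sum_congr rfl fun i _ => ?_
    rw [← Pi.single_smul, smul_eq_mul, mul_one]
  have hTflow : ∀ u, IsGeodesicFlow (directionFlow T u) ‖u‖ := by
    intro u t x
    rw [directionFlow_apply, hTd, norm_smul, Real.norm_eq_abs, mul_comm]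
  have hTinj : ∀ u u', T (Multiplicative.ofAdd u) = T (Multiplicative.ofAdd u') → u = u' := by
    intro u u' h
    obtain ⟨x⟩ := ‹Nonempty X›
    have h1 := hTd (u - u') x
    rw [sub_eq_add_neg, ofAdd_add, ofAdd_neg, map_mul, map_inv, h, mul_inv_cancel,
      isometryEquiv_one_apply, dist_self] at h1
    have := norm_eq_zero.1 h1.symm
    rwa [← sub_eq_add_neg, sub_eq_zero] at this
  have hev : ∀ i, e (Multiplicative.ofAdd (Pi.single i 1)) = T (Multiplicative.ofAdd (v i)) := by
    intro i
    rw [← hS1, hTS, hvi]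
  have hspan : ∀ P : E k → Prop, (∀ i (t : ℝ), P (t • v i)) → P 0 →
      (∀ a b, P a → P b → P (a + b)) → ∀ u, P u := by
    intro P h1 h0 hadd u
    rw [← v.sum_repr u]
    exact Finset.sum_induction _ P hadd h0 fun i _ => h1 i _
  refine ⟨T, v, hTd, hTe, ?_, ?_⟩
  · intro h hc u
    refine hspan (fun u => Commute h (T (Multiplicative.ofAdd u))) (fun i t => ?_) ?_ ?_
      (Multiplicative.toAdd u)
    · refine (hTflow (v i)).commute ?_ (Multiplicative.ofAdd t)
      rw [directionFlow_one, ← hev]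
      exact hc _
    · rw [ofAdd_zero, map_one]; exact Commute.one_right h
    · intro a b ha hb
      rw [ofAdd_add, map_mul]
      exact ha.mul_right hb
  · have hex : ∀ h : X ≃ᵢ X, (∀ n, ∃ m, h * e n = e m * h) → ∃ α : E k → E k,
        ∀ u, h * T (Multiplicative.ofAdd u) = T (Multiplicative.ofAdd (α u)) * h := by
      intro h hn
      -- For a basis direction, the conjugated flow and the flow towards `w` share their time-one
      -- map, a lattice element, so they coincide. Sums of such directions then give every `u`.
      have : ∀ u, ∃ w, h * T (Multiplicative.ofAdd u) = T (Multiplicative.ofAdd w) * h := by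
        refine hspan _ (fun i t => ?_) ⟨0, by rw [ofAdd_zero, map_one, mul_one, one_mul]⟩ ?_
        · obtain ⟨m, hm⟩ := hn (Multiplicative.ofAdd (Pi.single i 1))
          set w := ∑ j, (Multiplicative.toAdd m j : ℝ) • v j with hw
          have hmw : e m = T (Multiplicative.ofAdd w) := hTe (Multiplicative.toAdd m)
          have hfl : conjFlow h (directionFlow T (v i)) = directionFlow T w := by
            refine ((hTflow (v i)).conjFlow h).ext (hTflow w) ?_
            rw [conjFlow_apply, directionFlow_one, directionFlow_one, ← hmw, ← hev, hm,
              mul_inv_cancel_right]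
          refine ⟨t • w, ?_⟩
          have h1 := DFunLike.congr_fun hfl (Multiplicative.ofAdd t)
          rw [conjFlow_apply, directionFlow_apply, directionFlow_apply] at h1
          exact mul_inv_eq_iff_eq_mul.1 h1
        · rintro a b ⟨wa, ha⟩ ⟨wb, hb⟩
          refine ⟨wa + wb, ?_⟩
          rw [ofAdd_add, map_mul, ← mul_assoc, ha, mul_assoc, hb, ← mul_assoc, ofAdd_add, map_mul]
      choose α hα using this
      exact ⟨α, hα⟩
    intro h hn hn'
    obtain ⟨α, hα⟩ := hex h hn
    obtain ⟨α', hα'⟩ := hex h⁻¹ hn'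
    refine ⟨α, fun u => ⟨α' u, ?_⟩, hα⟩
    apply hTinj
    have h1 := hα (α' u)
    have h2 : h * T (Multiplicative.ofAdd (α' u)) = T (Multiplicative.ofAdd u) * h := by
      have h3 := hα' u
      calc h * T (Multiplicative.ofAdd (α' u))
          = h * (T (Multiplicative.ofAdd (α' u)) * h⁻¹) * h := by group
        _ = T (Multiplicative.ofAdd u) * h := by rw [← h3]; group
    exact mul_right_cancel (h1.symm.trans h2)

end Lattice

/-! ### From comparison triangles to the Bruhat–Tits inequality -/

section Comparison

theorem exists_comparison_triangle {a b d : ℝ} (ha : 0 ≤ a) (hb : 0 ≤ b)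
    (h1 : d ≤ a + b) (h2 : a ≤ b + d) (h3 : b ≤ a + d) :
    ∃ x y z : EuclideanSpace ℝ (Fin 2), dist x y = a ∧ dist x z = b ∧ dist y z = d := by
  have hd : 0 ≤ d := by linarith
  rcases ha.eq_or_lt with rfl | ha
  · have : b = d := by linarith
    subst this
    refine ⟨!₂[0, 0], !₂[0, 0], !₂[b, 0], ?_, ?_, ?_⟩ <;>
      simp [EuclideanSpace.dist_eq, Fin.sum_univ_two, Real.dist_eq, Real.sqrt_sq_eq_abs,
        abs_of_nonneg hb]
  · set p := (a ^ 2 + b ^ 2 - d ^ 2) / (2 * a) with hp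
    have hpa : 2 * a * p = a ^ 2 + b ^ 2 - d ^ 2 := by rw [hp]; field_simp
    have hq : 0 ≤ b ^ 2 - p ^ 2 := by
      have h4 : (2 * a * p) ^ 2 ≤ (2 * a * b) ^ 2 := by
        rw [hpa]
        apply sq_le_sq'
        · nlinarith
        · nlinarith
      have h5 : 0 < 4 * a ^ 2 := by positivity
      nlinarith
    refine ⟨!₂[0, 0], !₂[a, 0], !₂[p, √(b ^ 2 - p ^ 2)], ?_, ?_, ?_⟩
    · simp [EuclideanSpace.dist_eq, Fin.sum_univ_two, Real.dist_eq, Real.sqrt_sq_eq_abs,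
        abs_of_pos ha]
    · simp [EuclideanSpace.dist_eq, Fin.sum_univ_two, Real.dist_eq, Real.sq_sqrt hq,
        Real.sqrt_sq hb]
    · simp only [EuclideanSpace.dist_eq, Fin.sum_univ_two, Real.dist_eq, sq_abs]
      simp only [Matrix.cons_val_zero, Matrix.cons_val_one, zero_sub, neg_sq,
        Real.sq_sqrt hq]
      rw [show (a - p) ^ 2 + (b ^ 2 - p ^ 2) = d ^ 2 by linarith [hpa], Real.sqrt_sq hd]

theorem dist_lineMap_sq {V : Type*} [NormedAddCommGroup V] [InnerProductSpace ℝ V] (x y z : V)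
    (t : ℝ) : dist (AffineMap.lineMap x y t) z ^ 2 =
      (1 - t) * dist x z ^ 2 + t * dist y z ^ 2 - t * (1 - t) * dist x y ^ 2 := by
  have e1 : AffineMap.lineMap x y t - z = (1 - t) • (x - z) + t • (y - z) := by
    rw [AffineMap.lineMap_apply_module]
    module
  have e2 : ‖x - y‖ ^ 2 = ‖x - z‖ ^ 2 - 2 * inner ℝ (x - z) (y - z) + ‖y - z‖ ^ 2 := by
    rw [← norm_sub_sq_real, sub_sub_sub_cancel_right]
  rw [dist_eq_norm, dist_eq_norm, dist_eq_norm, dist_eq_norm, e1, e2, norm_add_sq_real,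
    norm_smul, norm_smul, inner_smul_left, inner_smul_right, mul_pow, mul_pow,
    Real.norm_eq_abs, Real.norm_eq_abs, sq_abs, sq_abs]
  simp only [conj_trivial]
  ring

/-- Compare the point at fraction `t` of one side with the opposite vertex, that is, with fraction
`1` of the second side; Stewart's formula (`dist_lineMap_sq`) computes the planar distance. -/
theorem IsCATZero.cnSpace {X : Type u} [MetricSpace X] (hX : IsCATZero X) : CNSpace X := by
  refine ⟨fun x y t ht => ?_⟩
  obtain ⟨hgeo, hcat⟩ := hX
  have hlen : ∀ (c : ℝ → X) (l : ℝ), IsGeodesicOn c l → dist (c 0) (c l) = l := by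
    intro c l hc
    rw [hc.2 0 ⟨le_rfl, hc.1⟩ l ⟨hc.1, le_rfl⟩, zero_sub, abs_neg, abs_of_nonneg hc.1]
  obtain ⟨c₁, a, hc₁, rfl, rfl⟩ := hgeo x y
  refine ⟨c₁ (t * a), fun z => ?_⟩
  obtain ⟨c₂, b, hc₂, h0, rfl⟩ := hgeo (c₁ 0) z
  have ha := hlen c₁ a hc₁
  have hb := hlen c₂ b hc₂
  obtain ⟨x', y', z', h1, h2, h3⟩ := exists_comparison_triangle (a := a) (b := b)
    (d := dist (c₁ a) (c₂ b)) hc₁.1 hc₂.1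
    (by have := dist_triangle_left (c₁ a) (c₂ b) (c₁ 0)
        rw [ha, ← h0, hb] at this; exact this)
    (by have := dist_triangle_right (c₁ 0) (c₁ a) (c₂ b)
        rw [ha, ← h0, hb] at this; exact this)
    (by have := dist_triangle (c₁ 0) (c₁ a) (c₂ b)
        rw [ha, ← h0, hb] at this; exact this)
  have h := hcat c₁ c₂ a b hc₁ hc₂ h0.symm x' y' z' h1 h2 h3 t ht 1 ⟨zero_le_one, le_rfl⟩
  rw [one_mul, AffineMap.lineMap_apply_one] at h
  have hsq := pow_le_pow_left₀ dist_nonneg h 2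
  rw [dist_lineMap_sq, h2, h3, h1] at hsq
  rw [dist_comm (c₂ b), dist_comm (c₂ b), ← h0, hb, h0, dist_comm (c₂ b), ha]
  exact hsq

end Comparison

/-! ### Semisimple elements of discrete nilpotent groups -/

section Groups

variable {X : Type u} [MetricSpace X]

theorem mem_minSet_one (x : X) : x ∈ minSet (1 : X ≃ᵢ X) := fun y => by
  rw [isometryEquiv_one_apply, isometryEquiv_one_apply, dist_self, dist_self]

theorem le_of_forall_nat_mul_le {a b c : ℝ} (h : ∀ n : ℕ, n * a ≤ n * b + c) : a ≤ b := by
  by_contra hab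
  push Not at hab
  obtain ⟨n, hn⟩ := exists_nat_gt (c / (a - b))
  rw [div_lt_iff₀ (sub_pos.2 hab)] at hn
  have := h n
  linarith

/-- Along the powers `g ^ (m * n)` the displacement at `x` grows exactly linearly in `n`, that at
`y` at most linearly with slope `dist y ((g ^ m) y)`, and the two stay at bounded difference. -/
theorem mem_minSet_pow [CNSpace X] {g : X ≃ᵢ X} {x : X} (hx : x ∈ minSet g) (m : ℕ) :
    x ∈ minSet (g ^ m) := by
  intro y
  refine le_of_forall_nat_mul_le (c := 2 * dist x y) fun n => ?_
  have h1 := dist_pow_of_mem_minSet g hx (m * n)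
  have h2 := dist_pow_le (g ^ m) y n
  rw [← pow_mul] at h2
  have h3 := abs_le.1 (abs_dist_apply_sub_dist_apply_le (g ^ (m * n)) x y)
  rw [dist_pow_of_mem_minSet g hx m]
  push_cast at h1
  linarith

theorem minSet_mul_nonempty [CNSpace X] [CompleteSpace X] {g h : X ≃ᵢ X} (hc : Commute g h)
    (hg : (minSet g).Nonempty) (hh : (minSet h).Nonempty) :
    (minSet g ∩ minSet h).Nonempty :=
  (isCNConvex_minSet g).inter_minSet_nonempty (isClosed_minSet g) hg h
    (apply_mem_minSet_iff_of_commute hc) hh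

theorem minSet_conj_nonempty {g : X ≃ᵢ X} (hg : (minSet g).Nonempty) (c : X ≃ᵢ X) :
    (minSet (c * g * c⁻¹)).Nonempty := by
  obtain ⟨x, hx⟩ := hg
  exact ⟨c x, (apply_mem_minSet_conj_iff g c x).2 hx⟩

theorem exists_forall_mem_minSet [CNSpace X] [CompleteSpace X] [Nonempty X]
    (F : Finset (X ≃ᵢ X)) (hc : ∀ g ∈ F, ∀ h ∈ F, Commute g h)
    (hne : ∀ g ∈ F, (minSet g).Nonempty) : ∃ x, ∀ g ∈ F, x ∈ minSet g := by
  classical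
  have hset : ∀ F : Finset (X ≃ᵢ X), {x | ∀ g ∈ F, x ∈ minSet g} = ⋂ g ∈ F, minSet g := by
    intro F; ext x; simp
  induction F using Finset.induction_on with
  | empty => exact ⟨Classical.arbitrary X, by simp⟩
  | insert g F hg ih =>
    obtain ⟨x₀, hx₀⟩ := ih (fun a ha b hb => hc a (Finset.mem_insert_of_mem ha) b
      (Finset.mem_insert_of_mem hb)) fun a ha => hne a (Finset.mem_insert_of_mem ha)
    have hconv : IsCNConvex {x | ∀ g ∈ F, x ∈ minSet g} := fun x hx y hy t h0 h1 a ha =>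
      isCNConvex_minSet a x (hx a ha) y (hy a ha) t h0 h1
    have hcl : IsClosed {x | ∀ g ∈ F, x ∈ minSet g} := by
      rw [hset]
      exact isClosed_biInter fun a _ => isClosed_minSet a
    obtain ⟨x, hx, hxg⟩ := hconv.inter_minSet_nonempty hcl ⟨x₀, hx₀⟩ g
      (fun x => forall₂_congr fun a ha => apply_mem_minSet_iff_of_commute
        (hc a (Finset.mem_insert_of_mem ha) g (Finset.mem_insert_self _ _)) x)
      (hne g (Finset.mem_insert_self _ _))
    refine ⟨x, fun a ha => ?_⟩
    rcases Finset.mem_insert.1 ha with rfl | ha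
    · exact hxg
    · exact hx a ha

/-- A finitely generated abelian group of semisimple isometries has a common minimal set. -/
theorem exists_forall_mem_minSet_of_fg [CNSpace X] [CompleteSpace X] [Nonempty X]
    (A : Subgroup (X ≃ᵢ X)) (hA : A.FG) (hc : ∀ g ∈ A, ∀ h ∈ A, Commute g h)
    (hne : ∀ g ∈ A, (minSet g).Nonempty) : ∃ x, ∀ g ∈ A, x ∈ minSet g := by
  obtain ⟨F, rfl⟩ := hA
  obtain ⟨x, hx⟩ := exists_forall_mem_minSet F
    (fun g hg h hh => hc g (Subgroup.subset_closure hg) h (Subgroup.subset_closure hh))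
    (fun g hg => hne g (Subgroup.subset_closure hg))
  refine ⟨x, fun g hg => ?_⟩
  induction hg using Subgroup.closure_induction with
  | mem g h => exact hx g h
  | one => exact mem_minSet_one x
  | mul g h hg hh h1 h2 => exact minSet_inter_minSet_subset (hc g hg h hh) ⟨h1, h2⟩
  | inv g _ h => rw [minSet_inv]; exact h

theorem IsDiscreteGroup.isOfFinOrder {Γ : Subgroup (X ≃ᵢ X)} (hΓ : IsDiscreteGroup Γ)
    {g : X ≃ᵢ X} (hg : g ∈ Γ) {x : X} (hx : g x = x) : IsOfFinOrder g := by
  by_contra h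
  have hinj := injective_pow_iff_not_isOfFinOrder.2 h
  refine Set.infinite_range_of_injective hinj ((hΓ x 1 zero_le_one).subset ?_)
  rintro _ ⟨n, rfl⟩
  refine ⟨pow_mem hg n, ?_⟩
  have : dist x ((g ^ n) x) ≤ 0 := by
    have := dist_pow_le g x n
    rwa [hx, dist_self, mul_zero] at this
  linarith

/-- In a torsion-free nilpotent discrete group of isometries, semisimple elements are central. -/
theorem semisimple_central [CNSpace X] [CompleteSpace X] {Γ : Subgroup (X ≃ᵢ X)}
    (hΓ : IsDiscreteGroup Γ) (N : Subgroup Γ) (hN : Group.IsNilpotent N)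
    (htf : ∀ x ∈ N, IsOfFinOrder x → x = 1) (a : Γ) (ha : a ∈ N)
    (has : (minSet (a : X ≃ᵢ X)).Nonempty) (n : Γ) (hn : n ∈ N) : a * n = n * a := by
  have hcoe : ∀ {g h : N}, Commute g h → Commute ((g : Γ) : X ≃ᵢ X) ((h : Γ) : X ≃ᵢ X) := by
    intro g h hgh
    exact (hgh.map N.subtype).map Γ.subtype
  have key := subset_center_of_isNilpotent {g : N | (minSet ((g : Γ) : X ≃ᵢ X)).Nonempty}
    (fun g hg c => minSet_conj_nonempty hg _)
    (fun g hg => by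
      change (minSet (((g : Γ) : X ≃ᵢ X)⁻¹)).Nonempty
      rw [minSet_inv]; exact hg)
    (fun g hg h hh hgh => (minSet_mul_nonempty (hcoe hgh) hg hh).mono
      (minSet_inter_minSet_subset (hcoe hgh)))
    (fun h hh z hz hhz hconj => ?_) ⟨a, ha⟩ has
  · have := Subgroup.mem_center_iff.1 key ⟨n, hn⟩
    exact (congrArg Subtype.val this).symm
  · obtain ⟨x, hxh, hxz⟩ := minSet_mul_nonempty (hcoe hhz) hh hz
    set h' : X ≃ᵢ X := ((h : Γ) : X ≃ᵢ X) with hh'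
    set z' : X ≃ᵢ X := ((z : Γ) : X ≃ᵢ X) with hz'
    -- `h * z ^ n` attains its minimal displacement at `x`, and being conjugate to `h` it moves some
    -- point by `dist x (h x)`. Its displacement at `x` is also at least `n * dist x (z x) - dist x
    -- (h x)`.
    have hle : dist x (z' x) ≤ 0 := by
      refine le_of_forall_nat_mul_le (c := 2 * dist x (h' x)) fun n => ?_
      obtain ⟨c, hc⟩ := hconj n
      have hc' : ((c : Γ) : X ≃ᵢ X) * h' * ((c : Γ) : X ≃ᵢ X)⁻¹ = h' * z' ^ n := by
        have := congrArg (fun g : N => ((g : Γ) : X ≃ᵢ X)) hc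
        simpa using this
      have hmin := minSet_inter_minSet_subset ((hcoe hhz).pow_right n)
        ⟨hxh, mem_minSet_pow hxz n⟩
      have h1 := hmin (((c : Γ) : X ≃ᵢ X) x)
      rw [← hh', ← hz'] at h1
      have h2 : (h' * z' ^ n) (((c : Γ) : X ≃ᵢ X) x) = ((c : Γ) : X ≃ᵢ X) (h' x) := by
        rw [← hc', IsometryEquiv.mul_apply, IsometryEquiv.inv_apply_self,
          IsometryEquiv.mul_apply]
      rw [h2, IsometryEquiv.dist_eq, IsometryEquiv.mul_apply] at h1
      have h3 := dist_pow_of_mem_minSet z' hxz n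
      have h4 : dist (h' x) (h' ((z' ^ n) x)) = dist x ((z' ^ n) x) := h'.dist_eq _ _
      have h5 := dist_triangle_left (h' x) (h' ((z' ^ n) x)) x
      linarith
    have hfix : z' x = x := (dist_le_zero.1 hle).symm
    have h6 := hΓ.isOfFinOrder (z : Γ).2 hfix
    exact Subtype.ext (htf z z.2 (Submonoid.isOfFinOrder_coe.1 h6))

/-- The semisimple elements of a subgroup in which they are central. -/
def semisimpleSubgroup [CNSpace X] [CompleteSpace X] [Nonempty X] {Γ : Subgroup (X ≃ᵢ X)}
    (N : Subgroup Γ)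
    (hN : ∀ a ∈ N, (minSet (a : X ≃ᵢ X)).Nonempty → ∀ n ∈ N, a * n = n * a) : Subgroup Γ where
  carrier := {a | a ∈ N ∧ (minSet (a : X ≃ᵢ X)).Nonempty}
  mul_mem' := fun {a b} ha hb => by
    have hc : Commute (a : X ≃ᵢ X) (b : X ≃ᵢ X) :=
      (show Commute a b from hN a ha.1 ha.2 b hb.1).map Γ.subtype
    exact ⟨mul_mem ha.1 hb.1, (minSet_mul_nonempty hc ha.2 hb.2).mono
      (minSet_inter_minSet_subset hc)⟩
  one_mem' := ⟨one_mem N, ⟨Classical.arbitrary X, mem_minSet_one _⟩⟩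
  inv_mem' := fun {a} ha => ⟨inv_mem ha.1, by
    change (minSet ((a : X ≃ᵢ X)⁻¹)).Nonempty
    rw [minSet_inv]; exact ha.2⟩

theorem semisimpleSubgroup_normal [CNSpace X] [CompleteSpace X] [Nonempty X]
    {Γ : Subgroup (X ≃ᵢ X)} (N : Subgroup Γ) [hNn : N.Normal]
    (hN : ∀ a ∈ N, (minSet (a : X ≃ᵢ X)).Nonempty → ∀ n ∈ N, a * n = n * a) :
    (semisimpleSubgroup N hN).Normal :=
  ⟨fun a ha g => ⟨hNn.conj_mem a ha.1 g, minSet_conj_nonempty ha.2 _⟩⟩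

/-- A finitely generated torsion-free abelian group is free abelian. -/
theorem exists_mulEquiv_int_pow {G : Type*} [Group G] [Group.FG G] (hc : ∀ a b : G, a * b = b * a)
    (htf : ∀ a : G, IsOfFinOrder a → a = 1) :
    ∃ k : ℕ, Nonempty (Multiplicative (Fin k → ℤ) ≃* G) := by
  let _ : CommGroup G := { (inferInstance : Group G) with mul_comm := hc }
  have hfin : Module.Finite ℤ (Additive G) := Module.Finite.iff_addGroup_fg.mpr inferInstance
  have : IsMulTorsionFree G := isMulTorsionFree_iff_not_isOfFinOrder.2
    fun a ha h => ha (htf a h)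
  have : Module.Free ℤ (Additive G) := inferInstance
  exact ⟨Module.finrank ℤ (Additive G),
    ⟨(Module.finBasis ℤ (Additive G)).equivFun.symm.toAddEquiv.toMultiplicativeLeft⟩⟩

end Groups

/-! ### The flat torus theorem for a normal subgroup -/

section Splitting

/-- The action of a group of isometries on an invariant subset. -/
def restrictAction {X : Type*} [MetricSpace X] (Γ : Subgroup (X ≃ᵢ X)) (C : Set X)
    (hC : ∀ (γ : Γ) (x : X), (γ : X ≃ᵢ X) x ∈ C ↔ x ∈ C) : Γ →* (C ≃ᵢ C) where
  toFun γ := restrictIsometry γ C (hC γ)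
  map_one' := rfl
  map_mul' _ _ := rfl

/-- The flat torus theorem for a free abelian normal subgroup of semisimple isometries. -/
theorem exists_invariant_splitting {X : Type u} [MetricSpace X] [CNSpace X] [CompleteSpace X]
    [Nonempty X] {Γ : Subgroup (X ≃ᵢ X)} (hΓ : IsDiscreteGroup Γ) (A : Subgroup Γ) [hAn : A.Normal]
    (hA : ∀ a ∈ A, (minSet (a : X ≃ᵢ X)).Nonempty) {k : ℕ}
    (e : Multiplicative (Fin k → ℤ) ≃* A) :
    ∃ (W : Type u) (_ : MetricSpace W) (_ : Nonempty W) (φ : WithLp 2 (W × E k) → X)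
      (ρ : Γ →* (W ≃ᵢ W)) (σ : Γ →* (E k ≃ᵢ E k)) (v : Module.Basis (Fin k) ℝ (E k)),
      CNSpace W ∧ Isometry φ ∧ IsCNConvex (range φ) ∧ IsClosed (range φ) ∧
      (∀ (γ : Γ) (x : X), (γ : X ≃ᵢ X) x ∈ range φ ↔ x ∈ range φ) ∧
      (∀ (γ : Γ) (w : W) (u : E k),
        (γ : X ≃ᵢ X) (φ (WithLp.toLp 2 (w, u))) = φ (WithLp.toLp 2 (ρ γ w, σ γ u))) ∧
      (∀ n : Fin k → ℤ, ρ (e (Multiplicative.ofAdd n)) = 1 ∧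
        ∀ u : E k, σ (e (Multiplicative.ofAdd n)) u = u + ∑ i, (n i : ℝ) • v i) ∧
      ∀ γ : Γ, (∀ a ∈ A, γ * a = a * γ) → ∃ t, ∀ u, σ γ u = u + t := by
  have hAc : ∀ a b : A, Commute a b := by
    intro a b
    obtain ⟨m, rfl⟩ := e.surjective a
    obtain ⟨n, rfl⟩ := e.surjective b
    exact (Commute.all m n).map e
  have hAfg : Group.FG A := Group.fg_of_surjective (f := e.toMonoidHom) e.surjective
  obtain ⟨x₀, hx₀⟩ : ∃ x, ∀ a ∈ A, x ∈ minSet (a : X ≃ᵢ X) := by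
    obtain ⟨x, hx⟩ := exists_forall_mem_minSet_of_fg (A.map Γ.subtype)
      (subgroup_fg_map ((Group.fg_iff_subgroup_fg A).1 hAfg) _) (by
        rintro _ ⟨a, ha, rfl⟩ _ ⟨b, hb, rfl⟩
        exact ((hAc ⟨a, ha⟩ ⟨b, hb⟩).map A.subtype).map Γ.subtype) (by
        rintro _ ⟨a, ha, rfl⟩
        exact hA a ha)
    exact ⟨x, fun a ha => hx _ ⟨a, ha, rfl⟩⟩
  set C : Set X := {x | ∀ a ∈ A, x ∈ minSet (a : X ≃ᵢ X)} with hCdef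
  have hCconv : IsCNConvex C := fun x hx y hy t h0 h1 a ha =>
    isCNConvex_minSet _ x (hx a ha) y (hy a ha) t h0 h1
  have hCcl : IsClosed C := by
    have : C = ⋂ a ∈ A, minSet (a : X ≃ᵢ X) := by ext x; simp [hCdef]
    rw [this]
    exact isClosed_biInter fun a _ => isClosed_minSet _
  have hCsub : ∀ (γ : Γ) (x : X), x ∈ C → (γ : X ≃ᵢ X) x ∈ C := by
    intro γ x hx a ha
    have h1 := hAn.conj_mem a ha γ⁻¹
    have h2 := (apply_mem_minSet_conj_iff _ (γ : X ≃ᵢ X) x).2 (hx _ h1)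
    have h3 : (γ : X ≃ᵢ X) * ((γ⁻¹ * a * γ⁻¹⁻¹ : Γ) : X ≃ᵢ X) * (γ : X ≃ᵢ X)⁻¹ =
        (a : X ≃ᵢ X) := by
      have : γ * (γ⁻¹ * a * γ⁻¹⁻¹) * γ⁻¹ = a := by group
      exact congrArg Subtype.val this
    rwa [h3] at h2
  have hCinv : ∀ (γ : Γ) (x : X), (γ : X ≃ᵢ X) x ∈ C ↔ x ∈ C := by
    refine fun γ x => ⟨fun h => ?_, hCsub γ x⟩
    have := hCsub γ⁻¹ _ h
    rwa [show ((γ⁻¹ : Γ) : X ≃ᵢ X) ((γ : X ≃ᵢ X) x) = x from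
      IsometryEquiv.inv_apply_self _ _] at this
  have hCcn : CNSpace C := hCconv.cnSpace
  have hCne : Nonempty C := ⟨⟨x₀, hx₀⟩⟩
  set act := restrictAction Γ C hCinv with hact
  have hactc : ∀ γ (x : C), ((act γ x : C) : X) = (γ : X ≃ᵢ X) x := fun _ _ => rfl
  set e' : Multiplicative (Fin k → ℤ) →* (C ≃ᵢ C) :=
    (act.comp A.subtype).comp e.toMonoidHom with he'
  have he'a : ∀ n, e' n = act (e n) := fun _ => rfl
  obtain ⟨T, v, hTd, hTe, hTc, hTn⟩ := exists_euclidean_translation_action e'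
    (fun n => ⟨_, hasConstDisplacement_restrict_of_subset _ C (hCinv _)
      (fun x hx => hx _ (e n).2) hx₀⟩)
    (fun x η => by
      refine Set.Finite.preimage (f := fun n : Fin k → ℤ =>
        (((e (Multiplicative.ofAdd n) : A) : Γ) : X ≃ᵢ X)) ?_ (hΓ x (max η 0) (le_max_right _ _))
        |>.subset ?_
      · intro m _ n _ hmn
        exact Multiplicative.ofAdd.injective
          (e.injective (Subtype.ext (Subtype.ext hmn)))
      · intro n hn
        exact ⟨Subtype.property _, lt_max_of_lt_left hn⟩)
  obtain ⟨W, φ, hWne, hWcn, hφ, hφs, hφT, hφh⟩ := exists_product_decomposition T hTd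
  have hWne' : Nonempty W := hWne.to_subtype
  have hnorm : ∀ (γ : Γ) n, ∃ m, act γ * e' n = e' m * act γ := by
    intro γ n
    obtain ⟨m, hm⟩ := e.surjective ⟨γ * e n * γ⁻¹, hAn.conj_mem _ (e n).2 γ⟩
    refine ⟨m, ?_⟩
    rw [he'a, he'a, hm, ← map_mul, ← map_mul, inv_mul_cancel_right]
  obtain ⟨ρ, σ, hρσ⟩ := exists_component_homs act φ hφ (fun γ => by
    obtain ⟨α, hα, hαT⟩ := hTn (act γ) (hnorm γ) (by
      rw [← map_inv]; exact hnorm γ⁻¹)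
    obtain ⟨r, t, hrt⟩ := hφh (act γ) α hα hαT
    exact ⟨r, fun u => α u + t, hrt⟩)
  have hcomp : ∀ (γ : Γ) (w w' : W) (u u' : E k),
      act γ (φ (WithLp.toLp 2 (w, u))) = φ (WithLp.toLp 2 (w', u')) →
      ρ γ w = w' ∧ σ γ u = u' := by
    intro γ w w' u u' h
    rw [hρσ] at h
    have h1 := hφ.injective h
    exact ⟨congrArg WithLp.fst h1, congrArg WithLp.snd h1⟩
  have hrange : range (fun p => (φ p : X)) = C := by
    ext x
    constructor
    · rintro ⟨p, rfl⟩
      exact (φ p).2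
    · intro hx
      obtain ⟨p, hp⟩ := hφs ⟨x, hx⟩
      exact ⟨p, congrArg Subtype.val hp⟩
  refine ⟨W, inferInstance, hWne', fun p => φ p, ρ, σ, v, hWcn,
    isometry_subtype_coe.comp hφ, by rw [hrange]; exact hCconv, by rw [hrange]; exact hCcl,
    by rw [hrange]; exact hCinv,
    fun γ w u => congrArg Subtype.val (hρσ γ w u), fun n => ?_, fun γ hγ => ?_⟩
  · have key : ∀ w u, act (e (Multiplicative.ofAdd n)) (φ (WithLp.toLp 2 (w, u))) =
        φ (WithLp.toLp 2 (w, u + ∑ i, (n i : ℝ) • v i)) := by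
      intro w u
      rw [← he'a, hTe, hφT, hφT, add_comm, ofAdd_add, map_mul, IsometryEquiv.mul_apply]
    constructor
    · ext1 w
      exact (hcomp _ _ _ _ _ (key w 0)).1
    · intro u
      exact (hcomp _ _ _ _ _ (key (Classical.arbitrary W) u)).2
  · have h1 : ∀ n, Commute (act γ) (e' n) := by
      intro n
      have : Commute γ (e n : Γ) := hγ _ (e n).2
      exact this.map act
    -- Commuting with the lattice implies commuting with all translations, so the linear part is the
    -- identity.
    obtain ⟨r, t, hrt⟩ := hφh (act γ) id Function.surjective_id (fun u => hTc _ h1 _)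
    refine ⟨t, fun u => ?_⟩
    exact (hcomp _ _ _ _ _ (hrt (Classical.arbitrary W) u)).2

/-- Every vector can be moved into a bounded set by a lattice. -/
theorem exists_norm_add_lattice_le {k : ℕ} (v : Module.Basis (Fin k) ℝ (E k)) (t : E k) :
    ∃ n : Fin k → ℤ, ‖t + ∑ i, (n i : ℝ) • v i‖ ≤ ∑ i, ‖v i‖ := by
  refine ⟨fun i => -⌊v.repr t i⌋, ?_⟩
  have : t + ∑ i, ((-⌊v.repr t i⌋ : ℤ) : ℝ) • v i = ∑ i, Int.fract (v.repr t i) • v i := by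
    nth_rewrite 1 [← v.sum_repr t]
    rw [← Finset.sum_add_distrib]
    refine Finset.sum_congr rfl fun i _ => ?_
    rw [← add_smul]
    congr 1
    push_cast
    rw [← sub_eq_add_neg]
    rfl
  rw [this]
  refine (norm_sum_le _ _).trans (Finset.sum_le_sum fun i _ => ?_)
  rw [norm_smul, Real.norm_eq_abs, abs_of_nonneg (Int.fract_nonneg _)]
  exact mul_le_of_le_one_left (norm_nonneg _) (Int.fract_lt_one _).le

end Splitting

end CATZero

end

/-! ### The proposition -/

theorem proposition2p6 {X : Type u} [MetricSpace X] [CompleteSpace X] [Nonempty X]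
    (hX : CATZero.IsCATZero X) (hdim : CATZero.geometricDimension X < ⊤)
    (Γ : Subgroup (X ≃ᵢ X)) (hfg : Group.FG Γ) (hdisc : CATZero.IsDiscreteGroup Γ)
    (hnil : Group.IsVirtuallyNilpotent Γ) :
    -- the product `W × ℝᵏ`, embedded in `X` by `φ`, and the two components `ρ`, `σ` of the action
    (∃ (k : ℕ) (W : Type u) (_ : MetricSpace W) (_ : Nonempty W)
        (φ : WithLp 2 (W × CATZero.E k) → X)
        (ρ : Γ →* (W ≃ᵢ W)) (σ : Γ →* (CATZero.E k ≃ᵢ CATZero.E k))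
        (H ΓW Z : Subgroup Γ) (e : Multiplicative (Fin k → ℤ) ≃* Z)
        (v : Module.Basis (Fin k) ℝ (CATZero.E k)) (S : Subgroup Γ),
      -- (i)
      (Isometry φ ∧ CATZero.IsGeodesicallyConvex (Set.range φ) ∧
        (∀ (γ : Γ) (w : W) (u : CATZero.E k),
          (γ : X ≃ᵢ X) (φ (WithLp.toLp 2 (w, u))) = φ (WithLp.toLp 2 (ρ γ w, σ γ u))) ∧
        ∀ γ : Γ, ¬ CATZero.IsHyperbolic (ρ γ)) ∧
      -- (ii)
      (H.Normal ∧ H.FiniteIndex ∧ CATZero.IsInternalDirectProduct H ΓW Z ∧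
        (Group.FG ΓW ∧ Group.IsNilpotent ΓW ∧ Set.InjOn ρ ΓW ∧
          CATZero.IsDiscreteGroup (ΓW.map ρ) ∧ ∀ g ∈ ΓW, ¬ CATZero.IsHyperbolic (ρ g)) ∧
        -- `Z ≅ ℤᵏ` fixes `W` and acts on `ℝᵏ` as the translation lattice with basis `v`
        (∀ n : Fin k → ℤ, ρ (e (Multiplicative.ofAdd n)) = 1 ∧
          ∀ u : CATZero.E k, σ (e (Multiplicative.ofAdd n)) u = u + ∑ i, (n i : ℝ) • v i)) ∧
      -- (iii)
      ((S : Set Γ) = {γ : Γ | γ ∈ H ∧ CATZero.IsSemisimple (γ : X ≃ᵢ X)} ∧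
        (S : Set Γ) = {γ : Γ | γ ∈ H ∧ CATZero.IsElliptic (ρ γ)} ∧
        S.Normal ∧ CATZero.IsVirtuallyAbelian S)) ∧
    -- (iv)
    ((∀ γ ∈ Γ, ¬ CATZero.IsParabolic γ) → CATZero.IsVirtuallyAbelian Γ) := by
  open CATZero in
  have : CNSpace X := hX.cnSpace
  obtain ⟨N, hNn, hNfin, hNnil, hNtf⟩ := exists_normal_nilpotent_torsionFree hnil
  have hcen : ∀ a ∈ N, (minSet (a : X ≃ᵢ X)).Nonempty → ∀ n ∈ N, a * n = n * a :=
    fun a ha has n hn => semisimple_central hdisc N hNnil hNtf a ha has n hn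
  set A := semisimpleSubgroup N hcen with hAdef
  have hAN : A ≤ N := fun a ha => ha.1
  have hAn : A.Normal := semisimpleSubgroup_normal N hcen
  have hNfg : Group.FG N := inferInstance
  have hAcomm : ∀ a ∈ A, ∀ n ∈ N, a * n = n * a := fun a ha => hcen a ha.1 ha.2
  have hFG : ∀ K ≤ N, Group.FG K := by
    intro K hK
    have := subgroup_fg_map (subgroup_fg_of_isNilpotent (K.subgroupOf N)) N.subtype
    rwa [Subgroup.map_subgroupOf_eq_of_le hK, ← Group.fg_iff_subgroup_fg] at this
  have hAfg := hFG A hAN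
  have hAab : ∀ a b : A, a * b = b * a :=
    fun a b => Subtype.ext (hAcomm a a.2 b (hAN b.2))
  obtain ⟨k, ⟨e⟩⟩ := exists_mulEquiv_int_pow hAab (fun a ha =>
    Subtype.ext (hNtf a (hAN a.2) (Submonoid.isOfFinOrder_coe.2 ha)))
  obtain ⟨W, mW, neW, φ, ρ, σ, v, hWcn, hφ, hconv, hclosed, hinv, hact, he, htrans⟩ :=
    exists_invariant_splitting hdisc A (fun a ha => ha.2) e
  have htransN : ∀ γ ∈ N, ∃ t, ∀ u, σ γ u = u + t :=
    fun γ hγ => htrans γ fun a ha => (hAcomm a ha γ hγ).symm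
  have hρA : ∀ a ∈ A, ρ a = 1 := by
    intro a ha
    obtain ⟨n, hn⟩ := e.surjective ⟨a, ha⟩
    have := (he (Multiplicative.toAdd n)).1
    rwa [ofAdd_toAdd, hn] at this
  have hdist : ∀ (γ : Γ) (w : W) (u : E k), dist (φ (WithLp.toLp 2 (w, u)))
      ((γ : X ≃ᵢ X) (φ (WithLp.toLp 2 (w, u)))) ^ 2 = dist w (ρ γ w) ^ 2 + dist u (σ γ u) ^ 2 := by
    intro γ w u
    rw [hact, hφ.dist_eq]
    exact dist_sq_withLp _ _
  have htd : ∀ (u t : E k), dist u (u + t) = ‖t‖ := fun u t => by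
    rw [dist_eq_norm, sub_add_cancel_left, norm_neg]
  -- Since `γ` translates `ℝᵏ` by a fixed `t`, its squared displacement on the product is that on
  -- `W` plus `‖t‖ ^ 2`. A minimum on `W` thus gives one on the product, and by projection one on
  -- `X`.
  have hss : ∀ γ ∈ N, (minSet (ρ γ)).Nonempty → γ ∈ A := by
    rintro γ hγ ⟨w, hw⟩
    obtain ⟨t, ht⟩ := htransN γ hγ
    refine ⟨hγ, φ (WithLp.toLp 2 (w, 0)), ?_⟩
    refine hconv.mem_minSet hclosed _ (hinv γ) ⟨_, rfl⟩ ?_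
    rintro _ ⟨p, rfl⟩
    have h1 := hdist γ w 0
    have h2 := hdist γ p.fst p.snd
    rw [ht, htd] at h1 h2
    have h3 := pow_le_pow_left₀ dist_nonneg (hw p.fst) 2
    refine abs_le_of_sq_le_sq' ?_ dist_nonneg |>.2
    have h4 : WithLp.toLp 2 (p.fst, p.snd) = p := rfl
    rw [h4] at h2
    rw [h1, h2]
    linarith
  have hnh : ∀ γ : Γ, ¬ IsHyperbolic (ρ γ) := by
    rintro γ ⟨hs, hne⟩
    obtain ⟨w, hw⟩ := isSemisimple_iff.1 hs
    rw [translationLength_of_mem_minSet hw] at hne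
    -- A power lying in `N` is still semisimple on `W`, hence lies in `A` and acts trivially there,
    -- while powers of a hyperbolic isometry are nontrivial.
    have h1 : γ ^ N.index ∈ A := by
      refine hss _ (N.pow_index_mem γ) ⟨w, ?_⟩
      rw [map_pow]
      exact mem_minSet_pow hw _
    have h2 := hρA _ h1
    rw [map_pow] at h2
    have h3 := dist_pow_of_mem_minSet _ hw N.index
    rw [h2, isometryEquiv_one_apply, dist_self] at h3
    rcases mul_eq_zero.1 h3.symm with h | h
    · exact hNfin.index_ne_zero (by exact_mod_cast h)
    · exact hne h
  let _ : Module ℚ (E k) := Module.compHom _ (algebraMap ℚ ℝ)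
  -- The translation part, multiplicative because `N` acts on `ℝᵏ` by translations. It is injective
  -- on `A`, whose image has the basis `v`.
  let τ : N →* Multiplicative (E k) :=
    { toFun := fun γ => Multiplicative.ofAdd (σ γ 0)
      map_one' := by
        rw [Subgroup.coe_one, map_one]
        rfl
      map_mul' := fun γ γ' => by
        obtain ⟨t, ht⟩ := htransN γ γ.2
        rw [Subgroup.coe_mul, map_mul, IsometryEquiv.mul_apply, ht, ht 0, zero_add, add_comm,
          ofAdd_add] }
  obtain ⟨K, H, hHn, hHfin, hHN, hKH, hprod⟩ := exists_virtual_splitting N A hNfg hAN hAcomm τ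
    (by
      intro a ha haτ
      obtain ⟨n, hn⟩ := e.surjective ⟨a, ha⟩
      have h1 := (he (Multiplicative.toAdd n)).2 0
      rw [ofAdd_toAdd, hn, zero_add] at h1
      have h2 : σ a 0 = 0 := haτ
      have h3 : v.equivFun.symm (fun i => ((Multiplicative.toAdd n i : ℤ) : ℝ)) = 0 := by
        rw [Module.Basis.equivFun_symm_apply, ← h1]
        exact h2
      have h4 : n = 1 := by
        apply Multiplicative.toAdd.injective
        ext i
        have := congrFun ((LinearEquiv.map_eq_zero_iff _).1 h3) i
        exact Int.cast_eq_zero.1 this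
      rw [h4, map_one] at hn
      exact Subtype.ext (congrArg Subtype.val hn).symm)
  have hAH : A ≤ H := hprod.2.2 ▸ le_sup_right
  have hell : ∀ a ∈ A, IsElliptic (ρ a) := by
    intro a ha
    rw [hρA a ha]
    refine ⟨isSemisimple_iff.2 ⟨Classical.arbitrary W, mem_minSet_one _⟩, ?_⟩
    rw [translationLength_of_mem_minSet (mem_minSet_one (Classical.arbitrary W)),
      isometryEquiv_one_apply, dist_self]
  refine ⟨⟨k, W, mW, neW, φ, ρ, σ, H, K, A, e, v, A, ⟨hφ, hconv.isGeodesicallyConvex, hact, hnh⟩,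
    ⟨hHn, hHfin, hprod, ⟨hFG K (hKH.trans hHN), isNilpotent_of_le (hKH.trans hHN) hNnil, ?_, ?_,
      fun g _ => hnh g⟩, he⟩, ?_, ?_, hAn, ⊤, fun a _ b _ => hAab a b, inferInstance⟩, ?_⟩
  -- An element of `K` trivial on `W` is semisimple there, so it lies in `K ⊓ A = ⊥`.
  · intro a ha b hb hab
    have h1 : a⁻¹ * b ∈ K := mul_mem (inv_mem ha) hb
    have h2 : ρ (a⁻¹ * b) = 1 := by rw [map_mul, map_inv, hab, inv_mul_cancel]
    have h3 : a⁻¹ * b ∈ A := hss _ (hHN (hKH h1))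
      ⟨Classical.arbitrary W, by rw [h2]; exact mem_minSet_one _⟩
    have h4 : a⁻¹ * b ∈ K ⊓ A := ⟨h1, h3⟩
    rw [hprod.2.1, Subgroup.mem_bot] at h4
    exact inv_mul_eq_one.1 h4
  · intro w η hη
    set B := ∑ i, ‖v i‖
    have hB : 0 ≤ B := Finset.sum_nonneg fun i _ => norm_nonneg _
    set x := φ (WithLp.toLp 2 (w, 0))
    -- Multiplying by an element of `A` does not change the action on `W` and makes the translation
    -- part at most `B` long. Together with a displacement below `η` on `W` this keeps the total
    -- below `η + B + 1`, so discreteness on `X` applies.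
    have hfin : {γ : Γ | dist x ((γ : X ≃ᵢ X) x) < η + B + 1}.Finite := by
      refine ((hdisc x (η + B + 1) (by linarith)).preimage
        (f := fun γ : Γ => (γ : X ≃ᵢ X)) Subtype.val_injective.injOn).subset ?_
      intro γ hγ
      exact ⟨γ.2, hγ⟩
    refine (hfin.image ρ).subset ?_
    rintro _ ⟨⟨γ, hγ, rfl⟩, hlt⟩
    obtain ⟨t, ht⟩ := htransN γ (hHN (hKH hγ))
    obtain ⟨n, hn⟩ := exists_norm_add_lattice_le v t
    have hρe := (he n).1
    have hσe := (he n).2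
    set a : Γ := (e (Multiplicative.ofAdd n) : Γ)
    have hρ : ρ (γ * a) = ρ γ := by rw [map_mul, hρe, mul_one]
    refine ⟨γ * a, ?_, hρ⟩
    have h1 := hdist (γ * a) w 0
    rw [hρ, map_mul, IsometryEquiv.mul_apply, hσe, ht, zero_add, add_comm _ t,
      dist_zero_left] at h1
    change dist x _ < _
    refine abs_lt_of_sq_lt_sq' ?_ (by linarith) |>.2
    have h2 := dist_nonneg (x := w) (y := ρ γ w)
    have h3 := norm_nonneg (t + ∑ i, (n i : ℝ) • v i)
    rw [h1]
    nlinarith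
  · ext γ
    exact ⟨fun h => ⟨hAH h, isSemisimple_iff.2 h.2⟩, fun h => ⟨hHN h.1, isSemisimple_iff.1 h.2⟩⟩
  · ext γ
    exact ⟨fun h => ⟨hAH h, hell γ h⟩, fun h => hss γ (hHN h.1) (isSemisimple_iff.1 h.2.1)⟩
  · intro hpar
    have hNA : N ≤ A := fun n hn => ⟨hn, isSemisimple_iff.1 (not_not.1 (hpar n n.2))⟩
    exact ⟨N, fun a ha b hb => hAcomm a (hNA ha) b hb, hNfin⟩
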